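/- Let $q\in(0,1)$ and let $\mathcal A$ be the polynomial function algebra of the quantum group $SU_q(2)$: the universal unital $*$-algebra generated by $\alpha,\gamma$ with $$\alpha^*\alpha+\gamma^*\gamma=1,\quad \alpha\alpha^*+q^2\gamma^*\gamma=1,\quad \gamma^*\gamma=\gamma\gamma^*,\quad \alpha\gamma=q\gamma\alpha,\quad \alpha\gamma^*=q\gamma^*\alpha,$$ with comultiplication $\Delta(\alpha)=\alpha\otimes\alpha-q\gamma^*\otimes\gamma$, $\Delta(\gamma)=\gamma\otimes\alpha+\alpha^*\otimes\gamma$, and Haar state $h$. Let $k^{\pm1},e,f$ be the generators of $U_q(\mathfrak{su}_2)$, with $\hat\Delta(k)=k\otimes k$, $\hat\Delta(e)=e\otimes k^{-1}+k\otimes e$, $\hat\Delta(f)=f\otimes k^{-1}+k\otimes f$, paired with $\mathcal A$ by $\omega(u_{ij})=\pi(\omega)_{ij}$, where $$u=\begin{pmatrix}\alpha&-q\gamma^*\\ \gamma&\alpha^*\end{pmatrix},\quad \pi(k)=\begin{pmatrix}q^{1/2}&0\\0&q^{-1/2}\end{pmatrix},\quad \pi(e)=\begin{pmatrix}0&1\\0&0\end{pmatrix},\quad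 \pi(f)=\begin{pmatrix}0&0\\1&0\end{pmatrix}.$$ Put $\partial_\omega(a)=(\iota\otimes\omega)\Delta(a)$ and $a\triangleleft\omega=(\omega\otimes\iota)\Delta(a)$. Let $\mathcal B=\{b\in\mathcal A:\partial_k(b)=b\}$ be the coordinate algebra of the quantum sphere $S^2_q$, with the twist $\sigma(b)=b\triangleleft k^2$. Let $C^n_\sigma(\mathcal B)$ be the space of linear functionals $\varphi$ on $\mathcal B^{\otimes(n+1)}$ with $\varphi(\sigma(b_0),\dots,\sigma(b_n))=\varphi(b_0,\dots,b_n)$. Set $$(b\varphi)(b_0,\dots,b_{n+1})=\sum_{i=0}^{n}(-1)^i\varphi(b_0,\dots,b_ib_{i+1},\dots,b_{n+1})+(-1)^{n+1}\varphi(\sigma(b_{n+1})b_0,b_1,\dots,b_n),$$ $$(\lambda\varphi)(b_0,\dots,b_n)=(-1)^n\varphi(\sigma(b_n),b_0,\dots,b_{n-1})$$ for $\varphi\in C^n_\sigma(\mathcal B)$, and $B=\big(\sum_{i=0}^n\lambda^i\big)B_0\colon C^{n+1}_\sigma(\mathcal B)\to C^n_\sigma(\mathcal B)$, where $$(B_0\varphi)(b_0,\dots,b_n)=\varphi(1,b_0,\dots,b_n)-(-1)^{n+1}\varphi(b_0,\dots,b_n,1).$$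 The twisted cyclic complex is $(C^\bullet_{\sigma,\lambda}(\mathcal B),b)$ with $C^n_{\sigma,\lambda}(\mathcal B)=\ker(1-\lambda)\subset C^n_\sigma(\mathcal B)$. The twisted $(b,B)$-complex is the $\mathbb Z/2$-graded complex with spaces $\mathcal C^0_\sigma(\mathcal B)=\bigoplus_n C^{2n}_\sigma(\mathcal B)$, $\mathcal C^1_\sigma(\mathcal B)=\bigoplus_n C^{2n+1}_\sigma(\mathcal B)$ and differential $b+B$. For $b_0,b_1,b_2\in\mathcal B$ define $$\tau_1(b_0,b_1,b_2)=h(b_0\,\partial_e(b_1)\partial_f(b_2)),\qquad \tau_2(b_0,b_1,b_2)=h(b_0\,\partial_f(b_1)\partial_e(b_2)),$$ $$\tau(b_0,b_1,b_2)=h\big(b_0\,(q^2\partial_e(b_1)\partial_f(b_2)-\partial_f(b_1)\partial_e(b_2))\big).$$ **Proposition.** (i) The volume form $\tau$ is a $2$-cocycle in the twisted cyclic complex $(C^\bullet_{\sigma,\lambda}(\mathcal B),b)$. (ii) $\tau_1$ and $\tau_2$ are cocycles in the twisted $(b,B)$-complex $(\mathcal C^\bullet_\sigma(\mathcal B),b+B)$.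 (iii) The cocycle $q^2\tau_1+\tau_2\in\mathcal C^0_\sigma(\mathcal B)$ is a coboundary in the twisted $(b,B)$-complex; in particular $\tau$, $2q^2\tau_1$ and $-2\tau_2$ are cocycles in $\mathcal C^0_\sigma(\mathcal B)$ and are cohomologous to each other there. -/

import Mathlib

noncomputable section

open scoped TensorProduct

/-! ## Twisted cyclic cochains -/

namespace TwistedCyclic

section Complexes

variable {B : Type*} [Ring B] [Algebra ℂ B]

/-- Functions of `n + 1` variables in `B`; the operators of the cyclic theory are given on them by
the usual formulas. -/
abbrev PreCochain (B : Type*) (n : ℕ) : Type _ := (Fin (n + 1) → B) → ℂ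

/-- `C^n_σ(B)`: the `(n+1)`-linear functionals `f` on `B` (that is, the linear functionals on
`B^{⊗(n+1)}`) with `f(σ(b₀), …, σ(bₙ)) = f(b₀, …, bₙ)`. -/
def cochains (σ : B →ₐ[ℂ] B) (n : ℕ) : Submodule ℂ (PreCochain B n) where
  carrier := {f | (∃ F : MultilinearMap ℂ (fun _ : Fin (n + 1) => B) ℂ, ∀ b, F b = f b) ∧
    ∀ b, f (fun i => σ (b i)) = f b}
  zero_mem' := ⟨⟨0, fun _ => rfl⟩, fun _ => rfl⟩
  add_mem' := by
    rintro f g ⟨⟨F, hF⟩, hf⟩ ⟨⟨G, hG⟩, hg⟩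
    refine ⟨⟨F + G, fun b => ?_⟩, fun b => ?_⟩
    · simp [hF, hG]
    · simp [hf, hg]
  smul_mem' := by
    rintro c f ⟨⟨F, hF⟩, hf⟩
    refine ⟨⟨c • F, fun b => ?_⟩, fun b => ?_⟩
    · simp [hF]
    · simp [hf]

/-- The coboundary operator
`(b f)(b₀, …, bₙ₊₁) = ∑_{j=0}^{n} (-1)^j f(b₀, …, b_j b_{j+1}, …, bₙ₊₁)
  + (-1)^{n+1} f(σ(bₙ₊₁) b₀, b₁, …, bₙ)`. -/
def bOp (σ : B →ₐ[ℂ] B) (n : ℕ) (f : PreCochain B n) : PreCochain B (n + 1) := fun b =>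
  ∑ j : Fin (n + 1), (-1 : ℂ) ^ (j : ℕ) * f (Fin.contractNth j.castSucc (· * ·) b) +
    (-1 : ℂ) ^ (n + 1) *
      f (Fin.cons (σ (b (Fin.last (n + 1))) * b 0) (fun i : Fin n => b i.succ.castSucc))

/-- The cyclic operator `(λ f)(b₀, …, bₙ) = (-1)^n f(σ(bₙ), b₀, …, bₙ₋₁)`. -/
def lambdaOp (σ : B →ₐ[ℂ] B) (n : ℕ) (f : PreCochain B n) : PreCochain B n := fun b =>
  (-1 : ℂ) ^ n * f (Fin.cons (σ (b (Fin.last n))) (fun i : Fin n => b i.castSucc))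

/-- The operator `N = ∑_{i=0}^{n} λ^i`. -/
def nOp (σ : B →ₐ[ℂ] B) (n : ℕ) (f : PreCochain B n) : PreCochain B n :=
  ∑ i ∈ Finset.range (n + 1), (lambdaOp σ n)^[i] f

/-- The operator
`(B₀ f)(b₀, …, bₙ) = f(1, b₀, …, bₙ) - (-1)^{n+1} f(b₀, …, bₙ, 1)`. -/
def bZeroOp (n : ℕ) (f : PreCochain B (n + 1)) : PreCochain B n := fun b =>
  f (Fin.cons (1 : B) b) - (-1 : ℂ) ^ (n + 1) * f (Fin.snoc b (1 : B))

/-- The operator `B = N B₀`, lowering the degree by one. -/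
def bigBOp (σ : B →ₐ[ℂ] B) (n : ℕ) (f : PreCochain B (n + 1)) : PreCochain B n :=
  nOp σ n (bZeroOp n f)

/-- A cocycle of degree `n` in the twisted cyclic complex `(C^•_{σ,λ}(B), b)`, where
`C^n_{σ,λ}(B) = Ker(1 - λ) ⊆ C^n_σ(B)`. -/
def IsCyclicCocycle (σ : B →ₐ[ℂ] B) (n : ℕ) (f : PreCochain B n) : Prop :=
  f ∈ cochains σ n ∧ lambdaOp σ n f = f ∧ bOp σ n f = 0

/-- The spaces `𝓒^0_σ(B) = ⨁ C^{2m}_σ(B)` and `𝓒^1_σ(B) = ⨁ C^{2m+1}_σ(B)`: finitely supported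
families of cochains, concentrated in degrees of the parity `k`. -/
def totalCochains (σ : B →ₐ[ℂ] B) (k : ZMod 2) : Submodule ℂ (∀ n : ℕ, PreCochain B n) where
  carrier := {f | (∀ n, f n ∈ cochains σ n) ∧ {n | f n ≠ 0}.Finite ∧
    ∀ n : ℕ, (n : ZMod 2) ≠ k → f n = 0}
  zero_mem' := ⟨fun n => (cochains σ n).zero_mem, by simp, fun _ _ => rfl⟩
  add_mem' := by
    rintro f g ⟨hf, hf', hf''⟩ ⟨hg, hg', hg''⟩
    refine ⟨fun n => (cochains σ n).add_mem (hf n) (hg n), (hf'.union hg').subset ?_,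
      fun n hn => ?_⟩
    · intro n hn
      by_contra h
      simp only [Set.mem_union, Set.mem_ofPred_eq, not_or, not_not] at h
      exact hn (by simp [h.1, h.2])
    · simp [hf'' n hn, hg'' n hn]
  smul_mem' := by
    rintro c f ⟨hf, hf', hf''⟩
    refine ⟨fun n => (cochains σ n).smul_mem c (hf n), hf'.subset ?_, fun n hn => ?_⟩
    · intro n hn h
      exact hn (by simp [h])
    · simp [hf'' n hn]

/-- The operator `b + B` on families of cochains: the component of degree `n` of `(b + B) f` is
`b f_{n-1} + B f_{n+1}`, where `f_{-1} = 0`. -/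
def bPlusB (σ : B →ₐ[ℂ] B) (f : ∀ n : ℕ, PreCochain B n) : ∀ n : ℕ, PreCochain B n
  | 0 => bigBOp σ 0 (f 1)
  | n + 1 => bOp σ n (f n) + bigBOp σ (n + 1) (f (n + 2))

/-- Cocycles of parity `k` in the complex `(𝓒^•_σ(B), b + B)`. -/
def IsTotalCocycle (σ : B →ₐ[ℂ] B) (k : ZMod 2) (f : ∀ n : ℕ, PreCochain B n) : Prop :=
  f ∈ totalCochains σ k ∧ bPlusB σ f = 0

/-- Coboundaries of parity `k` in the complex `(𝓒^•_σ(B), b + B)`: the elements `(b + B) g` with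
`g` a cochain of the other parity. -/
def IsTotalCoboundary (σ : B →ₐ[ℂ] B) (k : ZMod 2) (f : ∀ n : ℕ, PreCochain B n) : Prop :=
  f ∈ totalCochains σ k ∧ ∃ g ∈ totalCochains σ (k + 1), f = bPlusB σ g

/-- Two cocycles of parity `k` in `(𝓒^•_σ(B), b + B)` which differ by a coboundary. -/
def AreCohomologous (σ : B →ₐ[ℂ] B) (k : ZMod 2) (f g : ∀ n : ℕ, PreCochain B n) : Prop :=
  IsTotalCocycle σ k f ∧ IsTotalCocycle σ k g ∧ IsTotalCoboundary σ k (f - g)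

/-- A cochain of degree `n` as an element of the direct sum over all degrees. -/
def single (n : ℕ) (f : PreCochain B n) : ∀ m : ℕ, PreCochain B m := Pi.single n f

end Complexes

end TwistedCyclic

/-! ## The quantum group `SU_q(2)` -/

namespace QuantumSU2

/-- The number `q` as a complex number. -/
def qc (q : Set.Ioo (0 : ℝ) 1) : ℂ := ((q : ℝ) : ℂ)

/-- The generators `α`, `α^*`, `γ`, `γ^*`. -/
inductive Gen : Type
  | a | aStar | c | cStar

section Presentation

open FreeAlgebra Gen

/-- The defining relations of `SU_q(2)`, together with the adjoints of those that are not
selfadjoint. -/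
inductive Rel (q : Set.Ioo (0 : ℝ) 1) : FreeAlgebra ℂ Gen → FreeAlgebra ℂ Gen → Prop
  | aStar_a : Rel q (ι ℂ aStar * ι ℂ a + ι ℂ cStar * ι ℂ c) 1
  | a_aStar : Rel q (ι ℂ a * ι ℂ aStar + qc q ^ 2 • (ι ℂ cStar * ι ℂ c)) 1
  | cStar_c : Rel q (ι ℂ cStar * ι ℂ c) (ι ℂ c * ι ℂ cStar)
  | a_c : Rel q (ι ℂ a * ι ℂ c) (qc q • (ι ℂ c * ι ℂ a))
  | a_cStar : Rel q (ι ℂ a * ι ℂ cStar) (qc q • (ι ℂ cStar * ι ℂ a))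
  | cStar_aStar : Rel q (ι ℂ cStar * ι ℂ aStar) (qc q • (ι ℂ aStar * ι ℂ cStar))
  | c_aStar : Rel q (ι ℂ c * ι ℂ aStar) (qc q • (ι ℂ aStar * ι ℂ c))

end Presentation

/-- The algebra `𝓐` of polynomial functions on the quantum group `SU_q(2)` (the algebra spanned by
the matrix coefficients of its finite dimensional corepresentations): the universal unital
`*`-algebra generated by `α` and `γ` subject to the defining relations, that is, the universal
unital algebra generated by `α, α^*, γ, γ^*` subject to these relations and their adjoints. -/
def Poly (q : Set.Ioo (0 : ℝ) 1) : Type := RingQuot (Rel q)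

instance (q : Set.Ioo (0 : ℝ) 1) : Ring (Poly q) := inferInstanceAs (Ring (RingQuot (Rel q)))

instance (q : Set.Ioo (0 : ℝ) 1) : Algebra ℂ (Poly q) :=
  inferInstanceAs (Algebra ℂ (RingQuot (Rel q)))

variable (q : Set.Ioo (0 : ℝ) 1)

/-- The number `q^{1/2}` as a complex number. -/
def qs : ℂ := ((Real.sqrt (q : ℝ) : ℝ) : ℂ)

theorem q_pos : (0 : ℝ) < q := q.2.1

theorem qc_ne_zero : qc q ≠ 0 := by
  simpa [qc] using (q_pos q).ne'

theorem qs_mul_self : qs q * qs q = qc q := by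
  unfold qs qc
  rw [← Complex.ofReal_mul, Real.mul_self_sqrt (q_pos q).le]

theorem qs_ne_zero : qs q ≠ 0 := by
  intro h
  have := qs_mul_self q
  rw [h, zero_mul] at this
  exact qc_ne_zero q this.symm

/-- The quotient map from the free algebra. -/
def mk : FreeAlgebra ℂ Gen →ₐ[ℂ] Poly q := RingQuot.mkAlgHom ℂ (Rel q)

/-- The images of the generators in `𝓐`. -/
def gen (x : Gen) : Poly q := mk q (FreeAlgebra.ι ℂ x)

/-- The generator `α`. -/
def al : Poly q := gen q Gen.a
/-- The generator `α^*`. -/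
def alStar : Poly q := gen q Gen.aStar
/-- The generator `γ`. -/
def ga : Poly q := gen q Gen.c
/-- The generator `γ^*`. -/
def gaStar : Poly q := gen q Gen.cStar

theorem mk_rel {x y : FreeAlgebra ℂ Gen} (h : Rel q x y) : mk q x = mk q y :=
  RingQuot.mkAlgHom_rel ℂ h

theorem alStar_al : alStar q * al q + gaStar q * ga q = 1 := by
  simpa [al, alStar, ga, gaStar, gen] using mk_rel q Rel.aStar_a

theorem al_alStar : al q * alStar q + qc q ^ 2 • (gaStar q * ga q) = 1 := by
  simpa [al, alStar, ga, gaStar, gen] using mk_rel q Rel.a_aStar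

theorem gaStar_ga : gaStar q * ga q = ga q * gaStar q := by
  simpa [al, alStar, ga, gaStar, gen] using mk_rel q Rel.cStar_c

theorem al_ga : al q * ga q = qc q • (ga q * al q) := by
  simpa [al, alStar, ga, gaStar, gen] using mk_rel q Rel.a_c

theorem al_gaStar : al q * gaStar q = qc q • (gaStar q * al q) := by
  simpa [al, alStar, ga, gaStar, gen] using mk_rel q Rel.a_cStar

theorem gaStar_alStar : gaStar q * alStar q = qc q • (alStar q * gaStar q) := by
  simpa [al, alStar, ga, gaStar, gen] using mk_rel q Rel.cStar_aStar

theorem ga_alStar : ga q * alStar q = qc q • (alStar q * ga q) := by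
  simpa [al, alStar, ga, gaStar, gen] using mk_rel q Rel.c_aStar

section Lift

variable {R : Type*} [Ring R] [Algebra ℂ R]

/-- The universal property of `𝓐`. -/
def lift (a a' c c' : R) (h1 : a' * a + c' * c = 1) (h2 : a * a' + qc q ^ 2 • (c' * c) = 1)
    (h3 : c' * c = c * c') (h4 : a * c = qc q • (c * a)) (h5 : a * c' = qc q • (c' * a))
    (h6 : c' * a' = qc q • (a' * c')) (h7 : c * a' = qc q • (a' * c)) : Poly q →ₐ[ℂ] R :=
  RingQuot.liftAlgHom ℂ
    ⟨FreeAlgebra.lift ℂ (fun x : Gen => match x with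
      | Gen.a => a | Gen.aStar => a' | Gen.c => c | Gen.cStar => c'), by
      intro x y h
      cases h <;> simpa using by assumption⟩

variable (a a' c c' : R) (h1 : a' * a + c' * c = 1) (h2 : a * a' + qc q ^ 2 • (c' * c) = 1)
    (h3 : c' * c = c * c') (h4 : a * c = qc q • (c * a)) (h5 : a * c' = qc q • (c' * a))
    (h6 : c' * a' = qc q • (a' * c')) (h7 : c * a' = qc q • (a' * c))

theorem lift_al : lift q a a' c c' h1 h2 h3 h4 h5 h6 h7 (al q) = a :=
  (RingQuot.liftAlgHom_mkAlgHom_apply ..).trans (by simp)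

theorem lift_alStar : lift q a a' c c' h1 h2 h3 h4 h5 h6 h7 (alStar q) = a' :=
  (RingQuot.liftAlgHom_mkAlgHom_apply ..).trans (by simp)

theorem lift_ga : lift q a a' c c' h1 h2 h3 h4 h5 h6 h7 (ga q) = c :=
  (RingQuot.liftAlgHom_mkAlgHom_apply ..).trans (by simp)

theorem lift_gaStar : lift q a a' c c' h1 h2 h3 h4 h5 h6 h7 (gaStar q) = c' :=
  (RingQuot.liftAlgHom_mkAlgHom_apply ..).trans (by simp)

variable {q}

theorem hom_ext {f g : Poly q →ₐ[ℂ] R} (h1 : f (al q) = g (al q))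
    (h2 : f (alStar q) = g (alStar q)) (h3 : f (ga q) = g (ga q))
    (h4 : f (gaStar q) = g (gaStar q)) : f = g := by
  apply RingQuot.ringQuot_ext'
  apply FreeAlgebra.hom_ext
  funext x
  cases x
  · exact h1
  · exact h2
  · exact h3
  · exact h4

end Lift

theorem alStar_al' : alStar q * al q = 1 - ga q * gaStar q := by
  rw [← gaStar_ga, ← alStar_al q]; abel

theorem al_alStar' : al q * alStar q = 1 - qc q ^ 2 • (ga q * gaStar q) := by
  rw [← gaStar_ga, ← al_alStar q]; abel

set_option linter.unusedSimpArgs false in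
/-- The comultiplication of `𝓐`:
`Δ(α) = α ⊗ α - q γ^* ⊗ γ`, `Δ(γ) = γ ⊗ α + α^* ⊗ γ`, and `Δ` is a `*`-homomorphism. -/
def comulHom : Poly q →ₐ[ℂ] Poly q ⊗[ℂ] Poly q :=
  lift q (al q ⊗ₜ al q - qc q • (gaStar q ⊗ₜ ga q))
    (alStar q ⊗ₜ alStar q - qc q • (ga q ⊗ₜ gaStar q))
    (ga q ⊗ₜ al q + alStar q ⊗ₜ ga q)
    (gaStar q ⊗ₜ alStar q + al q ⊗ₜ gaStar q)
    (by
      simp only [mul_add, add_mul, mul_sub, sub_mul, smul_mul_assoc, mul_smul_comm,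
        Algebra.TensorProduct.tmul_mul_tmul, alStar_al', al_alStar', gaStar_ga, al_ga, al_gaStar, gaStar_alStar, ga_alStar,
        TensorProduct.tmul_add, TensorProduct.add_tmul, TensorProduct.tmul_sub,
        TensorProduct.sub_tmul, TensorProduct.tmul_smul, ← TensorProduct.smul_tmul',
        Algebra.TensorProduct.one_def]
      module)
    (by
      simp only [mul_add, add_mul, mul_sub, sub_mul, smul_mul_assoc, mul_smul_comm,
        Algebra.TensorProduct.tmul_mul_tmul, alStar_al', al_alStar', gaStar_ga, al_ga, al_gaStar, gaStar_alStar, ga_alStar,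
        TensorProduct.tmul_add, TensorProduct.add_tmul, TensorProduct.tmul_sub,
        TensorProduct.sub_tmul, TensorProduct.tmul_smul, ← TensorProduct.smul_tmul',
        Algebra.TensorProduct.one_def]
      module)
    (by
      simp only [mul_add, add_mul, mul_sub, sub_mul, smul_mul_assoc, mul_smul_comm,
        Algebra.TensorProduct.tmul_mul_tmul, alStar_al', al_alStar', gaStar_ga, al_ga, al_gaStar, gaStar_alStar, ga_alStar,
        TensorProduct.tmul_add, TensorProduct.add_tmul, TensorProduct.tmul_sub,
        TensorProduct.sub_tmul, TensorProduct.tmul_smul, ← TensorProduct.smul_tmul',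
        Algebra.TensorProduct.one_def]
      module)
    (by
      simp only [mul_add, add_mul, mul_sub, sub_mul, smul_mul_assoc, mul_smul_comm,
        Algebra.TensorProduct.tmul_mul_tmul, alStar_al', al_alStar', gaStar_ga, al_ga, al_gaStar, gaStar_alStar, ga_alStar,
        TensorProduct.tmul_add, TensorProduct.add_tmul, TensorProduct.tmul_sub,
        TensorProduct.sub_tmul, TensorProduct.tmul_smul, ← TensorProduct.smul_tmul',
        Algebra.TensorProduct.one_def]
      module)
    (by
      simp only [mul_add, add_mul, mul_sub, sub_mul, smul_mul_assoc, mul_smul_comm,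
        Algebra.TensorProduct.tmul_mul_tmul, alStar_al', al_alStar', gaStar_ga, al_ga, al_gaStar, gaStar_alStar, ga_alStar,
        TensorProduct.tmul_add, TensorProduct.add_tmul, TensorProduct.tmul_sub,
        TensorProduct.sub_tmul, TensorProduct.tmul_smul, ← TensorProduct.smul_tmul',
        Algebra.TensorProduct.one_def]
      module)
    (by
      simp only [mul_add, add_mul, mul_sub, sub_mul, smul_mul_assoc, mul_smul_comm,
        Algebra.TensorProduct.tmul_mul_tmul, alStar_al', al_alStar', gaStar_ga, al_ga, al_gaStar, gaStar_alStar, ga_alStar,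
        TensorProduct.tmul_add, TensorProduct.add_tmul, TensorProduct.tmul_sub,
        TensorProduct.sub_tmul, TensorProduct.tmul_smul, ← TensorProduct.smul_tmul',
        Algebra.TensorProduct.one_def]
      module)
    (by
      simp only [mul_add, add_mul, mul_sub, sub_mul, smul_mul_assoc, mul_smul_comm,
        Algebra.TensorProduct.tmul_mul_tmul, alStar_al', al_alStar', gaStar_ga, al_ga, al_gaStar, gaStar_alStar, ga_alStar,
        TensorProduct.tmul_add, TensorProduct.add_tmul, TensorProduct.tmul_sub,
        TensorProduct.sub_tmul, TensorProduct.tmul_smul, ← TensorProduct.smul_tmul',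
        Algebra.TensorProduct.one_def]
      module)

/-- The counit of `𝓐`. -/
def counitHom : Poly q →ₐ[ℂ] ℂ :=
  lift q 1 1 0 0 (by simp) (by simp) (by simp) (by simp) (by simp) (by simp) (by simp)

instance : Bialgebra ℂ (Poly q) :=
  Bialgebra.ofAlgHom (comulHom q) (counitHom q)
    (by
      apply hom_ext <;>
        simp [comulHom, lift_al, lift_alStar, lift_ga, lift_gaStar, TensorProduct.tmul_add,
          TensorProduct.add_tmul, TensorProduct.tmul_sub, TensorProduct.sub_tmul,
          TensorProduct.tmul_smul, ← TensorProduct.smul_tmul']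
      all_goals abel)
    (by
      apply hom_ext <;> simp [comulHom, counitHom, lift_al, lift_alStar, lift_ga, lift_gaStar])
    (by
      apply hom_ext <;> simp [comulHom, counitHom, lift_al, lift_alStar, lift_ga, lift_gaStar])

end QuantumSU2

/-! ### Left and right actions of functionals -/

namespace QuantumSU2

variable (q : Set.Ioo (0 : ℝ) 1)

/-- A subalgebra containing the generators is everything. -/
theorem eq_top_of_gen_mem {S : Subalgebra ℂ (Poly q)} (h1 : al q ∈ S) (h2 : alStar q ∈ S)
    (h3 : ga q ∈ S) (h4 : gaStar q ∈ S) : S = ⊤ := by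
  rw [eq_top_iff]
  rintro x -
  obtain ⟨y, rfl⟩ : ∃ y, mk q y = x := RingQuot.mkAlgHom_surjective ℂ (Rel q) x
  induction y using FreeAlgebra.induction with
  | grade0 r => simp
  | grade1 x =>
    cases x
    · exact h1
    · exact h2
    · exact h3
    · exact h4
  | mul a b ha hb => simpa using S.mul_mem ha hb
  | add a b ha hb => simpa using S.add_mem ha hb

variable {q}

/-- The slice map `ι ⊗ φ`. -/
def sliceL (φ : Module.Dual ℂ (Poly q)) : Poly q ⊗[ℂ] Poly q →ₗ[ℂ] Poly q :=
  (TensorProduct.rid ℂ (Poly q)).toLinearMap ∘ₗ LinearMap.lTensor (Poly q) φ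

/-- The slice map `φ ⊗ ι`. -/
def sliceR (φ : Module.Dual ℂ (Poly q)) : Poly q ⊗[ℂ] Poly q →ₗ[ℂ] Poly q :=
  (TensorProduct.lid ℂ (Poly q)).toLinearMap ∘ₗ LinearMap.rTensor (Poly q) φ

/-- The operator `∂_φ(a) = (ι ⊗ φ)Δ(a)`. -/
def del (φ : Module.Dual ℂ (Poly q)) : Poly q →ₗ[ℂ] Poly q :=
  sliceL φ ∘ₗ Coalgebra.comul

/-- The operator `a ↦ a ◁ φ = (φ ⊗ ι)Δ(a)`. -/
def act (φ : Module.Dual ℂ (Poly q)) : Poly q →ₗ[ℂ] Poly q :=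
  sliceR φ ∘ₗ Coalgebra.comul

@[simp] theorem sliceL_tmul (φ : Module.Dual ℂ (Poly q)) (a b : Poly q) :
    sliceL φ (a ⊗ₜ b) = φ b • a := by simp [sliceL]

@[simp] theorem sliceR_tmul (φ : Module.Dual ℂ (Poly q)) (a b : Poly q) :
    sliceR φ (a ⊗ₜ b) = φ a • b := by simp [sliceR]

theorem sliceL_mul {φ φ₁ φ₂ ψ₁ ψ₂ : Module.Dual ℂ (Poly q)}
    (h : ∀ a b, φ (a * b) = φ₁ a * φ₂ b + ψ₁ a * ψ₂ b) (x y : Poly q ⊗[ℂ] Poly q) :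
    sliceL φ (x * y) = sliceL φ₁ x * sliceL φ₂ y + sliceL ψ₁ x * sliceL ψ₂ y := by
  induction x with
  | zero => simp
  | add x x' hx hx' => rw [add_mul, map_add, hx, hx']; simp only [map_add, add_mul]; abel
  | tmul a b =>
    induction y with
    | zero => simp
    | add y y' hy hy' => rw [mul_add, map_add, hy, hy']; simp only [map_add, mul_add]; abel
    | tmul c d =>
      simp only [Algebra.TensorProduct.tmul_mul_tmul, sliceL_tmul, h, add_smul, smul_mul_smul_comm]

theorem sliceR_mul {φ φ₁ φ₂ ψ₁ ψ₂ : Module.Dual ℂ (Poly q)}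
    (h : ∀ a b, φ (a * b) = φ₁ a * φ₂ b + ψ₁ a * ψ₂ b) (x y : Poly q ⊗[ℂ] Poly q) :
    sliceR φ (x * y) = sliceR φ₁ x * sliceR φ₂ y + sliceR ψ₁ x * sliceR ψ₂ y := by
  induction x with
  | zero => simp
  | add x x' hx hx' => rw [add_mul, map_add, hx, hx']; simp only [map_add, add_mul]; abel
  | tmul a b =>
    induction y with
    | zero => simp
    | add y y' hy hy' => rw [mul_add, map_add, hy, hy']; simp only [map_add, mul_add]; abel
    | tmul c d =>
      simp only [Algebra.TensorProduct.tmul_mul_tmul, sliceR_tmul, h, add_smul, smul_mul_smul_comm]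

theorem del_mul {φ φ₁ φ₂ ψ₁ ψ₂ : Module.Dual ℂ (Poly q)}
    (h : ∀ a b, φ (a * b) = φ₁ a * φ₂ b + ψ₁ a * ψ₂ b) (a b : Poly q) :
    del φ (a * b) = del φ₁ a * del φ₂ b + del ψ₁ a * del ψ₂ b := by
  simp [del, Bialgebra.comul_mul, sliceL_mul h]

theorem act_mul {φ φ₁ φ₂ ψ₁ ψ₂ : Module.Dual ℂ (Poly q)}
    (h : ∀ a b, φ (a * b) = φ₁ a * φ₂ b + ψ₁ a * ψ₂ b) (a b : Poly q) :
    act φ (a * b) = act φ₁ a * act φ₂ b + act ψ₁ a * act ψ₂ b := by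
  simp [act, Bialgebra.comul_mul, sliceR_mul h]

@[simp] theorem del_one (φ : Module.Dual ℂ (Poly q)) : del φ 1 = φ 1 • 1 := by
  simp [del, Bialgebra.comul_one, Algebra.TensorProduct.one_def]

@[simp] theorem act_one (φ : Module.Dual ℂ (Poly q)) : act φ 1 = φ 1 • 1 := by
  simp [act, Bialgebra.comul_one, Algebra.TensorProduct.one_def]

theorem del_char_mul (χ : Poly q →ₐ[ℂ] ℂ) (a b : Poly q) :
    del χ.toLinearMap (a * b) = del χ.toLinearMap a * del χ.toLinearMap b := by
  have := del_mul (φ := χ.toLinearMap) (φ₁ := χ.toLinearMap) (φ₂ := χ.toLinearMap)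
    (ψ₁ := 0) (ψ₂ := 0) (by simp) a b
  simpa [del, sliceL] using this

theorem act_char_mul (χ : Poly q →ₐ[ℂ] ℂ) (a b : Poly q) :
    act χ.toLinearMap (a * b) = act χ.toLinearMap a * act χ.toLinearMap b := by
  have := act_mul (φ := χ.toLinearMap) (φ₁ := χ.toLinearMap) (φ₂ := χ.toLinearMap)
    (ψ₁ := 0) (ψ₂ := 0) (by simp) a b
  simpa [act, sliceR] using this

theorem comul_del (φ : Module.Dual ℂ (Poly q)) (a : Poly q) :
    Coalgebra.comul (R := ℂ) (del φ a) =
      LinearMap.lTensor (Poly q) (del φ) (Coalgebra.comul (R := ℂ) a) := by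
  have key : ∀ x : Poly q ⊗[ℂ] Poly q, Coalgebra.comul (R := ℂ) (sliceL φ x) =
      LinearMap.lTensor (Poly q) (sliceL φ) (TensorProduct.assoc ℂ _ _ _
        (LinearMap.rTensor (Poly q) (Coalgebra.comul (R := ℂ)) x)) := by
    intro x
    induction x with
    | zero => simp
    | add x y hx hy => simp only [map_add, hx, hy]
    | tmul u v =>
      simp only [sliceL_tmul, LinearMap.rTensor_tmul, map_smul]
      induction (Coalgebra.comul (R := ℂ) u) with
      | zero => simp
      | add x y hx hy => simp only [map_add, TensorProduct.add_tmul, smul_add, hx, hy]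
      | tmul c d => simp
  rw [del, LinearMap.comp_apply, key, Coalgebra.coassoc_apply, ← LinearMap.comp_apply,
    ← LinearMap.lTensor_comp]

theorem comul_act (φ : Module.Dual ℂ (Poly q)) (a : Poly q) :
    Coalgebra.comul (R := ℂ) (act φ a) =
      LinearMap.rTensor (Poly q) (act φ) (Coalgebra.comul (R := ℂ) a) := by
  have key : ∀ x : Poly q ⊗[ℂ] Poly q, Coalgebra.comul (R := ℂ) (sliceR φ x) =
      LinearMap.rTensor (Poly q) (sliceR φ) ((TensorProduct.assoc ℂ _ _ _).symm
        (LinearMap.lTensor (Poly q) (Coalgebra.comul (R := ℂ)) x)) := by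
    intro x
    induction x with
    | zero => simp
    | add x y hx hy => simp only [map_add, hx, hy]
    | tmul u v =>
      simp only [sliceR_tmul, LinearMap.lTensor_tmul, map_smul]
      induction (Coalgebra.comul (R := ℂ) v) with
      | zero => simp
      | add x y hx hy => simp only [map_add, TensorProduct.tmul_add, smul_add, hx, hy]
      | tmul c d => simp [TensorProduct.smul_tmul']
  rw [act, LinearMap.comp_apply, key, Coalgebra.coassoc_symm_apply, ← LinearMap.comp_apply,
    ← LinearMap.rTensor_comp]

theorem sliceL_rTensor (φ : Module.Dual ℂ (Poly q)) (g : Poly q →ₗ[ℂ] Poly q)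
    (x : Poly q ⊗[ℂ] Poly q) :
    sliceL φ (LinearMap.rTensor (Poly q) g x) = g (sliceL φ x) := by
  induction x with
  | zero => simp
  | add x y hx hy => simp only [map_add, hx, hy]
  | tmul u v => simp

theorem sliceL_lTensor (φ : Module.Dual ℂ (Poly q)) (g : Poly q →ₗ[ℂ] Poly q)
    (x : Poly q ⊗[ℂ] Poly q) :
    sliceL φ (LinearMap.lTensor (Poly q) g x) = sliceL (φ ∘ₗ g) x := by
  induction x with
  | zero => simp
  | add x y hx hy => simp only [map_add, hx, hy]
  | tmul u v => simp

/-- The left and the right action commute. -/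
theorem del_act (φ ψ : Module.Dual ℂ (Poly q)) (a : Poly q) :
    del φ (act ψ a) = act ψ (del φ a) := by
  rw [del, LinearMap.comp_apply, comul_act, sliceL_rTensor, LinearMap.comp_apply]

variable (q)

/-! ### The functionals on `𝓐` given by the generators of `U_q(su₂)`

The pairing of `ω ∈ U_q(su₂)` with the entries of the fundamental corepresentation
`u = [[α, -q γ^*], [γ, α^*]]` is `ω(u_{ij}) = π(ω)_{ij}`, where
`π(k) = diag(q^{1/2}, q^{-1/2})`, `π(e) = [[0, 1], [0, 0]]` and `π(f) = π(e)^* = [[0, 0], [1, 0]]`.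
On products it is computed by `Δ̂(k) = k ⊗ k`, `Δ̂(e) = e ⊗ k⁻¹ + k ⊗ e` and
`Δ̂(f) = f ⊗ k⁻¹ + k ⊗ f`; so `k` and `k⁻¹` are characters, and `e`, `f` are the upper right
entries of the homomorphisms `a ↦ [[k(a), e(a)], [0, k⁻¹(a)]]`, `a ↦ [[k(a), f(a)], [0, k⁻¹(a)]]`
into the two by two matrices. -/

/-- The character `k` of `𝓐`. -/
def kHom : Poly q →ₐ[ℂ] ℂ :=
  lift q (qs q) (qs q)⁻¹ 0 0 (by simp [qs_ne_zero]) (by simp [qs_ne_zero]) (by simp) (by simp)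
    (by simp) (by simp) (by simp)

/-- The character `k⁻¹` of `𝓐`. -/
def kInvHom : Poly q →ₐ[ℂ] ℂ :=
  lift q (qs q)⁻¹ (qs q) 0 0 (by simp [qs_ne_zero]) (by simp [qs_ne_zero]) (by simp) (by simp)
    (by simp) (by simp) (by simp)

/-- The homomorphism `a ↦ [[k(a), e(a)], [0, k⁻¹(a)]]`. -/
def eMat : Poly q →ₐ[ℂ] Matrix (Fin 2) (Fin 2) ℂ :=
  lift q !![qs q, 0; 0, (qs q)⁻¹] !![(qs q)⁻¹, 0; 0, qs q] 0 !![0, -(qc q)⁻¹; 0, 0]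
    (by simp [qs_ne_zero, Matrix.one_fin_two]) (by simp [qs_ne_zero, Matrix.one_fin_two])
    (by simp) (by simp)
    (by ext i j; fin_cases i <;> fin_cases j <;> simp [← qs_mul_self]; field_simp [qs_ne_zero])
    (by ext i j; fin_cases i <;> fin_cases j <;> simp [← qs_mul_self]; field_simp [qs_ne_zero])
    (by simp)

/-- The homomorphism `a ↦ [[k(a), f(a)], [0, k⁻¹(a)]]`. -/
def fMat : Poly q →ₐ[ℂ] Matrix (Fin 2) (Fin 2) ℂ :=
  lift q !![qs q, 0; 0, (qs q)⁻¹] !![(qs q)⁻¹, 0; 0, qs q] !![0, 1; 0, 0] 0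
    (by simp [qs_ne_zero, Matrix.one_fin_two]) (by simp [qs_ne_zero, Matrix.one_fin_two])
    (by simp)
    (by ext i j; fin_cases i <;> fin_cases j <;> simp [← qs_mul_self, qs_ne_zero])
    (by simp) (by simp)
    (by ext i j; fin_cases i <;> fin_cases j <;> simp [← qs_mul_self, qs_ne_zero])

/-- The functional `k` on `𝓐`. -/
def kFun : Module.Dual ℂ (Poly q) := (kHom q).toLinearMap

/-- The functional `k⁻¹` on `𝓐`. -/
def kInvFun : Module.Dual ℂ (Poly q) := (kInvHom q).toLinearMap

/-- The functional `e` on `𝓐`. -/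
def eFun : Module.Dual ℂ (Poly q) :=
  Matrix.entryLinearMap ℂ ℂ (0 : Fin 2) (1 : Fin 2) ∘ₗ (eMat q).toLinearMap

/-- The functional `f` on `𝓐`. -/
def fFun : Module.Dual ℂ (Poly q) :=
  Matrix.entryLinearMap ℂ ℂ (0 : Fin 2) (1 : Fin 2) ∘ₗ (fMat q).toLinearMap

theorem kFun_mul (a b : Poly q) : kFun q (a * b) = kFun q a * kFun q b := by simp [kFun]

theorem kInvFun_mul (a b : Poly q) : kInvFun q (a * b) = kInvFun q a * kInvFun q b := by
  simp [kInvFun]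

theorem eMat_entries (a : Poly q) :
    eMat q a 0 0 = kFun q a ∧ eMat q a 1 0 = 0 ∧ eMat q a 1 1 = kInvFun q a := by
  let S : Subalgebra ℂ (Poly q) :=
    { carrier := {a | eMat q a 0 0 = kFun q a ∧ eMat q a 1 0 = 0 ∧ eMat q a 1 1 = kInvFun q a}
      mul_mem' := by
        rintro a b ⟨h1, h2, h3⟩ ⟨h4, h5, h6⟩
        simp [Matrix.mul_apply, h1, h2, h3, h4, h5, h6, kFun_mul, kInvFun_mul]
      add_mem' := by
        rintro a b ⟨h1, h2, h3⟩ ⟨h4, h5, h6⟩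
        simp [h1, h2, h3, h4, h5, h6]
      algebraMap_mem' := fun r => by
        simp [kFun, kInvFun, Matrix.algebraMap_matrix_apply] }
  have hS : S = ⊤ := by
    apply eq_top_of_gen_mem <;>
      simp [S, ← SetLike.mem_coe, eMat, kFun, kInvFun, kHom, kInvHom, lift_al, lift_alStar, lift_ga,
        lift_gaStar]
  exact (hS ▸ Algebra.mem_top : a ∈ S)

theorem fMat_entries (a : Poly q) :
    fMat q a 0 0 = kFun q a ∧ fMat q a 1 0 = 0 ∧ fMat q a 1 1 = kInvFun q a := by
  let S : Subalgebra ℂ (Poly q) :=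
    { carrier := {a | fMat q a 0 0 = kFun q a ∧ fMat q a 1 0 = 0 ∧ fMat q a 1 1 = kInvFun q a}
      mul_mem' := by
        rintro a b ⟨h1, h2, h3⟩ ⟨h4, h5, h6⟩
        simp [Matrix.mul_apply, h1, h2, h3, h4, h5, h6, kFun_mul, kInvFun_mul]
      add_mem' := by
        rintro a b ⟨h1, h2, h3⟩ ⟨h4, h5, h6⟩
        simp [h1, h2, h3, h4, h5, h6]
      algebraMap_mem' := fun r => by
        simp [kFun, kInvFun, Matrix.algebraMap_matrix_apply] }
  have hS : S = ⊤ := by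
    apply eq_top_of_gen_mem <;>
      simp [S, ← SetLike.mem_coe, fMat, kFun, kInvFun, kHom, kInvHom, lift_al, lift_alStar, lift_ga,
        lift_gaStar]
  exact (hS ▸ Algebra.mem_top : a ∈ S)

/-- `Δ̂(e) = e ⊗ k⁻¹ + k ⊗ e`. -/
theorem eFun_mul (a b : Poly q) :
    eFun q (a * b) = eFun q a * kInvFun q b + kFun q a * eFun q b := by
  simp [eFun, Matrix.mul_apply, ← (eMat_entries q _).1, ← (eMat_entries q _).2.2, add_comm]

/-- `Δ̂(f) = f ⊗ k⁻¹ + k ⊗ f`. -/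
theorem fFun_mul (a b : Poly q) :
    fFun q (a * b) = fFun q a * kInvFun q b + kFun q a * fFun q b := by
  simp [fFun, Matrix.mul_apply, ← (fMat_entries q _).1, ← (fMat_entries q _).2.2, add_comm]

/-- The matrix `π(k)`. -/
theorem kFun_gen : kFun q (al q) = qs q ∧ kFun q (-qc q • gaStar q) = 0 ∧
    kFun q (ga q) = 0 ∧ kFun q (alStar q) = (qs q)⁻¹ := by
  simp [kFun, kHom, lift_al, lift_alStar, lift_ga, lift_gaStar]

/-- The matrix `π(k⁻¹)`. -/
theorem kInvFun_gen : kInvFun q (al q) = (qs q)⁻¹ ∧ kInvFun q (-qc q • gaStar q) = 0 ∧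
    kInvFun q (ga q) = 0 ∧ kInvFun q (alStar q) = qs q := by
  simp [kInvFun, kInvHom, lift_al, lift_alStar, lift_ga, lift_gaStar]

/-- The matrix `π(e)`. -/
theorem eFun_gen : eFun q (al q) = 0 ∧ eFun q (-qc q • gaStar q) = 1 ∧
    eFun q (ga q) = 0 ∧ eFun q (alStar q) = 0 := by
  simp [eFun, eMat, lift_al, lift_alStar, lift_ga, lift_gaStar, qc_ne_zero]

/-- The matrix `π(f)`. -/
theorem fFun_gen : fFun q (al q) = 0 ∧ fFun q (-qc q • gaStar q) = 0 ∧
    fFun q (ga q) = 1 ∧ fFun q (alStar q) = 0 := by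
  simp [fFun, fMat, lift_al, lift_alStar, lift_ga, lift_gaStar]

/-- The Woronowicz character `ρ = f_{-1} = k²`, that is, the convolution square
`ρ(a) = (k ⊗ k)Δ(a)`. -/
def rhoHom : Poly q →ₐ[ℂ] ℂ :=
  (Algebra.TensorProduct.lift (kHom q) (kHom q) (fun _ _ => Commute.all _ _)).comp
    (Bialgebra.comulAlgHom ℂ (Poly q))

/-! ### The quantum sphere -/

/-- The coordinate algebra `𝓑 = 𝓐₀ = {a ∈ 𝓐 | ∂_k(a) = a}` of the quantum sphere `S²_q`. -/
def Sphere : Subalgebra ℂ (Poly q) where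
  carrier := {a | del (kFun q) a = a}
  mul_mem' := by
    intro a b (ha : _ = _) (hb : _ = _)
    exact (del_char_mul (kHom q) a b).trans (congrArg₂ _ ha hb)
  add_mem' := by
    intro a b (ha : _ = _) (hb : _ = _)
    exact (map_add _ a b).trans (congrArg₂ _ ha hb)
  algebraMap_mem' := fun r => by
    simp [Algebra.algebraMap_eq_smul_one, kFun]

/-- The twist `σ(b) = b ◁ ρ` of `𝓑`. -/
def twist : Sphere q →ₐ[ℂ] Sphere q where
  toFun b := ⟨act (rhoHom q).toLinearMap b, by
    have hb : del (kFun q) (b : Poly q) = b := b.2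
    show del (kFun q) (act _ (b : Poly q)) = act _ (b : Poly q)
    rw [del_act, hb]⟩
  map_one' := by ext; simp
  map_mul' a b := by ext; exact act_char_mul (rhoHom q) a b
  map_zero' := by ext; simp
  map_add' a b := by ext; simp
  commutes' r := by ext; simp [Algebra.algebraMap_eq_smul_one]

end QuantumSU2

/-! ### The Haar state -/

namespace QuantumSU2

variable (q : Set.Ioo (0 : ℝ) 1)

variable {q} in
/-- `h` is the Haar state (on `𝓐`): the normalized functional that is invariant under the
comultiplication on both sides. -/
structure IsHaar (h : Module.Dual ℂ (Poly q)) : Prop where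
  map_one : h 1 = 1
  left_inv : ∀ a, del h a = algebraMap ℂ (Poly q) (h a)
  right_inv : ∀ a, act h a = algebraMap ℂ (Poly q) (h a)

theorem apply_sliceL (φ ψ : Module.Dual ℂ (Poly q)) (x : Poly q ⊗[ℂ] Poly q) :
    ψ (sliceL φ x) = φ (sliceR ψ x) := by
  induction x with
  | zero => simp
  | add x y hx hy => simp only [map_add, hx, hy]
  | tmul u v => simp [mul_comm]

theorem eq_of_invariant {h h' : Module.Dual ℂ (Poly q)} (h1 : h 1 = 1) (h1' : h' 1 = 1)
    (hl : ∀ a, del h a = algebraMap ℂ (Poly q) (h a))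
    (hr : ∀ a, act h' a = algebraMap ℂ (Poly q) (h' a)) : h = h' := by
  ext a
  have := apply_sliceL q h h' (Coalgebra.comul a)
  have e1 := hl a
  have e2 := hr a
  simp only [del, act, LinearMap.comp_apply] at e1 e2
  rw [e1, e2] at this
  simpa [Algebra.algebraMap_eq_smul_one, h1, h1'] using this

theorem IsHaar.unique {h h' : Module.Dual ℂ (Poly q)} (H : IsHaar h) (H' : IsHaar h') : h = h' :=
  eq_of_invariant q H.map_one H'.map_one H.left_inv H'.right_inv

/-! Existence of the Haar state: the operator `T = ∂_f ∂_e + ∂_k + ∂_{k⁻¹} - 2` is triangular on a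
spanning set, with `ℂ 1` as the only contribution to the eigenvalue zero, so that `𝓐` is the direct
sum of `ℂ 1` and the range of `T`; the projection onto `ℂ 1` is invariant. -/

section Existence

open scoped ComplexOrder

theorem qc_pos : 0 < qc q := by
  simpa [qc] using q_pos q

theorem qs_pos : 0 < qs q := by
  simpa [qs] using q_pos q

theorem qs_pow_ne_one {n : ℕ} (hn : n ≠ 0) : qs q ^ n ≠ 1 := by
  have h1 : Real.sqrt (q : ℝ) < 1 := by
    rw [Real.sqrt_lt' one_pos]; simpa using q.2.2
  have h2 : Real.sqrt (q : ℝ) ^ n < 1 := pow_lt_one₀ (Real.sqrt_nonneg _) h1 hn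
  intro h
  unfold qs at h
  norm_cast at h
  exact h2.ne h

theorem del_al (φ : Module.Dual ℂ (Poly q)) :
    del φ (al q) = φ (al q) • al q - (qc q * φ (ga q)) • gaStar q := by
  have : Coalgebra.comul (R := ℂ) (al q) = al q ⊗ₜ al q - qc q • (gaStar q ⊗ₜ ga q) :=
    lift_al ..
  simp [del, this, smul_smul]

theorem del_alStar (φ : Module.Dual ℂ (Poly q)) :
    del φ (alStar q) = φ (alStar q) • alStar q - (qc q * φ (gaStar q)) • ga q := by
  have : Coalgebra.comul (R := ℂ) (alStar q) =
      alStar q ⊗ₜ alStar q - qc q • (ga q ⊗ₜ gaStar q) := lift_alStar ..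
  simp [del, this, smul_smul]

theorem del_ga (φ : Module.Dual ℂ (Poly q)) :
    del φ (ga q) = φ (al q) • ga q + φ (ga q) • alStar q := by
  have : Coalgebra.comul (R := ℂ) (ga q) = ga q ⊗ₜ al q + alStar q ⊗ₜ ga q := lift_ga ..
  simp [del, this]

theorem del_gaStar (φ : Module.Dual ℂ (Poly q)) :
    del φ (gaStar q) = φ (alStar q) • gaStar q + φ (gaStar q) • al q := by
  have : Coalgebra.comul (R := ℂ) (gaStar q) = gaStar q ⊗ₜ alStar q + al q ⊗ₜ gaStar q :=
    lift_gaStar ..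
  simp [del, this]

theorem k_al : del (kFun q) (al q) = qs q • al q := by
  simp [del_al, kFun, kHom, lift_al, lift_ga]
theorem k_alStar : del (kFun q) (alStar q) = (qs q)⁻¹ • alStar q := by
  simp [del_alStar, kFun, kHom, lift_alStar, lift_gaStar]
theorem k_ga : del (kFun q) (ga q) = qs q • ga q := by
  simp [del_ga, kFun, kHom, lift_al, lift_ga]
theorem k_gaStar : del (kFun q) (gaStar q) = (qs q)⁻¹ • gaStar q := by
  simp [del_gaStar, kFun, kHom, lift_alStar, lift_gaStar]
theorem kInv_al : del (kInvFun q) (al q) = (qs q)⁻¹ • al q := by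
  simp [del_al, kInvFun, kInvHom, lift_al, lift_ga]
theorem kInv_alStar : del (kInvFun q) (alStar q) = qs q • alStar q := by
  simp [del_alStar, kInvFun, kInvHom, lift_alStar, lift_gaStar]
theorem kInv_ga : del (kInvFun q) (ga q) = (qs q)⁻¹ • ga q := by
  simp [del_ga, kInvFun, kInvHom, lift_al, lift_ga]
theorem kInv_gaStar : del (kInvFun q) (gaStar q) = qs q • gaStar q := by
  simp [del_gaStar, kInvFun, kInvHom, lift_alStar, lift_gaStar]
theorem e_al : del (eFun q) (al q) = 0 := by
  simp [del_al, eFun, eMat, lift_al, lift_ga]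
theorem e_alStar : del (eFun q) (alStar q) = ga q := by
  simp [del_alStar, eFun, eMat, lift_alStar, lift_gaStar, qc_ne_zero]
theorem e_ga : del (eFun q) (ga q) = 0 := by
  simp [del_ga, eFun, eMat, lift_al, lift_ga]
theorem e_gaStar : del (eFun q) (gaStar q) = -((qc q)⁻¹ • al q) := by
  simp [del_gaStar, eFun, eMat, lift_alStar, lift_gaStar]
theorem f_al : del (fFun q) (al q) = -(qc q • gaStar q) := by
  simp [del_al, fFun, fMat, lift_al, lift_ga]
theorem f_alStar : del (fFun q) (alStar q) = 0 := by
  simp [del_alStar, fFun, fMat, lift_alStar, lift_gaStar]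
theorem f_ga : del (fFun q) (ga q) = alStar q := by
  simp [del_ga, fFun, fMat, lift_al, lift_ga]
theorem f_gaStar : del (fFun q) (gaStar q) = 0 := by
  simp [del_gaStar, fFun, fMat, lift_alStar, lift_gaStar]

theorem k_mul (a b : Poly q) :
    del (kFun q) (a * b) = del (kFun q) a * del (kFun q) b := del_char_mul (kHom q) a b

theorem kInv_mul (a b : Poly q) :
    del (kInvFun q) (a * b) = del (kInvFun q) a * del (kInvFun q) b :=
  del_char_mul (kInvHom q) a b

theorem e_mul (a b : Poly q) : del (eFun q) (a * b) =
    del (eFun q) a * del (kInvFun q) b + del (kFun q) a * del (eFun q) b :=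
  del_mul (eFun_mul q) a b

theorem f_mul (a b : Poly q) : del (fFun q) (a * b) =
    del (fFun q) a * del (kInvFun q) b + del (kFun q) a * del (fFun q) b :=
  del_mul (fFun_mul q) a b

variable {q} in
/-- `x` is a weight vector of weight `t`. -/
def Wt (t : ℂ) (x : Poly q) : Prop :=
  0 < t ∧ del (kFun q) x = t • x ∧ del (kInvFun q) x = t⁻¹ • x

variable {q} in
theorem Wt.mul {t u : ℂ} {x y : Poly q} (hx : Wt t x) (hy : Wt u y) : Wt (t * u) (x * y) := by
  refine ⟨mul_pos hx.1 hy.1, ?_, ?_⟩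
  · rw [k_mul, hx.2.1, hy.2.1, smul_mul_smul_comm]
  · rw [kInv_mul, hx.2.2, hy.2.2, smul_mul_smul_comm, mul_inv]

theorem wt_one : Wt 1 (1 : Poly q) := by
  refine ⟨one_pos, ?_, ?_⟩ <;> simp [kFun, kInvFun]

variable {q} in
theorem Wt.pow {t : ℂ} {x : Poly q} (hx : Wt t x) (n : ℕ) : Wt (t ^ n) (x ^ n) := by
  induction n with
  | zero => simpa using wt_one q
  | succ n ih => simpa [pow_succ] using ih.mul hx

theorem wt_al : Wt (qs q) (al q) := ⟨qs_pos q, k_al q, kInv_al q⟩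
theorem wt_ga : Wt (qs q) (ga q) := ⟨qs_pos q, k_ga q, kInv_ga q⟩
theorem wt_alStar : Wt (qs q)⁻¹ (alStar q) :=
  ⟨inv_pos.2 (qs_pos q), k_alStar q, by simpa using kInv_alStar q⟩
theorem wt_gaStar : Wt (qs q)⁻¹ (gaStar q) :=
  ⟨inv_pos.2 (qs_pos q), k_gaStar q, by simpa using kInv_gaStar q⟩

variable {q} in
/-- `x z` is a positive multiple of `z x`. -/
def PC (x z : Poly q) : Prop := ∃ c : ℂ, 0 < c ∧ x * z = c • (z * x)

variable {q} in
theorem PC.symm {x z : Poly q} (h : PC x z) : PC z x := by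
  obtain ⟨c, hc, h⟩ := h
  exact ⟨c⁻¹, inv_pos.2 hc, by rw [h, smul_smul, inv_mul_cancel₀ hc.ne', one_smul]⟩

variable {q} in
theorem PC.pow {x z : Poly q} (h : PC x z) (n : ℕ) : PC x (z ^ n) := by
  induction n with
  | zero => exact ⟨1, one_pos, by simp⟩
  | succ n ih =>
    obtain ⟨c, hc, h⟩ := h
    obtain ⟨d, hd, ih⟩ := ih
    refine ⟨d * c, mul_pos hd hc, ?_⟩
    rw [pow_succ, ← mul_assoc, ih, smul_mul_assoc, mul_assoc, h, mul_smul_comm, smul_smul,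
      mul_assoc]

theorem pc_al_ga : PC (al q) (ga q) := ⟨_, qc_pos q, al_ga q⟩
theorem pc_al_gaStar : PC (al q) (gaStar q) := ⟨_, qc_pos q, al_gaStar q⟩
theorem pc_ga_alStar : PC (ga q) (alStar q) := ⟨_, qc_pos q, ga_alStar q⟩
theorem pc_gaStar_alStar : PC (gaStar q) (alStar q) := ⟨_, qc_pos q, gaStar_alStar q⟩

theorem e_ga_pow (n : ℕ) : del (eFun q) (ga q ^ n) = 0 := by
  induction n with
  | zero => simp [eFun]
  | succ n ih => rw [pow_succ, e_mul, ih, e_ga]; simp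

theorem e_al_pow (n : ℕ) : del (eFun q) (al q ^ n) = 0 := by
  induction n with
  | zero => simp [eFun]
  | succ n ih => rw [pow_succ, e_mul, ih, e_al]; simp

theorem f_gaStar_pow (n : ℕ) : del (fFun q) (gaStar q ^ n) = 0 := by
  induction n with
  | zero => simp [fFun]
  | succ n ih => rw [pow_succ, f_mul, ih, f_gaStar]; simp

theorem f_alStar_pow (n : ℕ) : del (fFun q) (alStar q ^ n) = 0 := by
  induction n with
  | zero => simp [fFun]
  | succ n ih => rw [pow_succ, f_mul, ih, f_alStar]; simp

/-- Twisted derivations on powers. -/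
theorem pow_aux {D : Poly q →ₗ[ℂ] Poly q} {x y : Poly q} {t : ℂ}
    (hD : ∀ a b, D (a * b) = D a * del (kInvFun q) b + del (kFun q) a * D b)
    (hx : Wt t x) (hxy : PC x y) (hDx : D x = y) (n : ℕ) :
    ∃ c : ℂ, 0 < c ∧ D (x ^ (n + 1)) = c • (y * x ^ n) := by
  induction n with
  | zero => exact ⟨1, one_pos, by simp [hDx]⟩
  | succ n ih =>
    obtain ⟨c, hc, ih⟩ := ih
    obtain ⟨d, hd, hxy⟩ := hxy
    have hw := hx.pow (n + 1)
    refine ⟨(t ^ (n + 1))⁻¹ + t * c * d, add_pos (inv_pos.2 hw.1)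
      (mul_pos (mul_pos hx.1 hc) hd), ?_⟩
    rw [pow_succ' x (n + 1), hD, hDx, ih, hw.2.2, hx.2.1, mul_smul_comm, smul_mul_smul_comm,
      ← mul_assoc x, hxy, smul_mul_assoc, smul_smul, add_smul, mul_assoc y, ← pow_succ']

theorem e_gaStar_pow (n : ℕ) : ∃ c : ℂ, 0 < c ∧
    del (eFun q) (gaStar q ^ (n + 1)) = -(c • (al q * gaStar q ^ n)) := by
  obtain ⟨c, hc, h⟩ := pow_aux q (D := -del (eFun q)) (x := gaStar q) (y := (qc q)⁻¹ • al q)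
    (by intro a b; simp only [LinearMap.neg_apply, e_mul]; simp only [neg_mul, mul_neg]; abel)
    (wt_gaStar q)
    (by
      obtain ⟨d, hd, h⟩ := (pc_al_gaStar q).symm
      exact ⟨d, hd, by rw [mul_smul_comm, h, smul_mul_assoc, smul_comm]⟩)
    (by simp [e_gaStar]) n
  refine ⟨c * (qc q)⁻¹, mul_pos hc (inv_pos.2 (qc_pos q)), ?_⟩
  rw [LinearMap.neg_apply, neg_eq_iff_eq_neg] at h
  rw [h, smul_mul_assoc, smul_smul]

theorem e_alStar_pow (n : ℕ) : ∃ c : ℂ, 0 < c ∧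
    del (eFun q) (alStar q ^ (n + 1)) = c • (ga q * alStar q ^ n) :=
  pow_aux q (e_mul q) (wt_alStar q) (pc_ga_alStar q).symm (e_alStar q) n

theorem f_ga_pow (n : ℕ) : ∃ c : ℂ, 0 < c ∧
    del (fFun q) (ga q ^ (n + 1)) = c • (alStar q * ga q ^ n) :=
  pow_aux q (f_mul q) (wt_ga q) (pc_ga_alStar q) (f_ga q) n

theorem f_al_pow (n : ℕ) : ∃ c : ℂ, 0 < c ∧
    del (fFun q) (al q ^ (n + 1)) = -(c • (gaStar q * al q ^ n)) := by
  obtain ⟨c, hc, h⟩ := pow_aux q (D := -del (fFun q)) (x := al q) (y := qc q • gaStar q)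
    (by intro a b; simp only [LinearMap.neg_apply, f_mul]; simp only [neg_mul, mul_neg]; abel)
    (wt_al q)
    (by
      obtain ⟨d, hd, h⟩ := pc_al_gaStar q
      exact ⟨d, hd, by rw [mul_smul_comm, h, smul_mul_assoc, smul_comm]⟩)
    (by simp [f_al]) n
  refine ⟨c * qc q, mul_pos hc (qc_pos q), ?_⟩
  rw [LinearMap.neg_apply, neg_eq_iff_eq_neg] at h
  rw [h, smul_mul_assoc, smul_smul]

/-- The monomials `α^i γ^j (γ^*)^l`. -/
def mon (i j l : ℕ) : Poly q := al q ^ i * ga q ^ j * gaStar q ^ l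

/-- The monomials `(α^*)^i γ^j (γ^*)^l`. -/
def mon' (i j l : ℕ) : Poly q := alStar q ^ i * ga q ^ j * gaStar q ^ l

theorem wt_mon (i j l : ℕ) : ∃ t, Wt t (mon q i j l) :=
  ⟨_, (((wt_al q).pow i).mul ((wt_ga q).pow j)).mul ((wt_gaStar q).pow l)⟩

theorem wt_mon' (i j l : ℕ) : ∃ t, Wt t (mon' q i j l) :=
  ⟨_, (((wt_alStar q).pow i).mul ((wt_ga q).pow j)).mul ((wt_gaStar q).pow l)⟩

theorem gaStar_comm_ga_pow (j : ℕ) : gaStar q * ga q ^ j = ga q ^ j * gaStar q :=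
  (Commute.pow_right (show Commute (gaStar q) (ga q) from gaStar_ga q) j).eq

theorem e_mon_zero (i j : ℕ) : del (eFun q) (mon q i j 0) = 0 := by
  simp [mon, e_mul, e_al_pow, e_ga_pow]

theorem e_mon (i j l : ℕ) : ∃ c : ℂ, 0 < c ∧
    del (eFun q) (mon q i j (l + 1)) = -(c • mon q (i + 1) j l) := by
  have hw := ((wt_al q).pow i).mul ((wt_ga q).pow j)
  obtain ⟨c, hc, h⟩ := e_gaStar_pow q l
  obtain ⟨d, hd, h'⟩ := ((pc_al_ga q).pow j).symm
  refine ⟨qs q ^ i * qs q ^ j * c * d, mul_pos (mul_pos hw.1 hc) hd, ?_⟩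
  rw [mon, e_mul, e_mul, e_al_pow, e_ga_pow, hw.2.1, h]
  simp only [zero_mul, mul_zero, add_zero, zero_add, mul_neg, smul_mul_smul_comm]
  congr 1
  rw [mon, pow_succ, ← mul_assoc, mul_assoc (al q ^ i), h']
  simp only [smul_mul_assoc, mul_smul_comm, smul_smul, mul_assoc]

theorem f_mon_aux (i j l : ℕ) : ∃ a b : ℂ, 0 < a ∧
    del (fFun q) (mon q (i + 1) (j + 1) l) = -(a • mon q i (j + 1) (l + 1)) + b • mon q i j l := by
  obtain ⟨c, hc, h⟩ := f_al_pow q i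
  obtain ⟨d, hd, h'⟩ := f_ga_pow q j
  have hwa := (wt_al q).pow (i + 1)
  have hwg := (wt_ga q).pow (j + 1)
  have hws := (wt_gaStar q).pow l
  obtain ⟨u, hu, hu'⟩ := (pc_al_gaStar q).symm.pow i
  refine ⟨c * (qs q ^ (j + 1))⁻¹ * ((qs q)⁻¹ ^ l)⁻¹ * u +
    qs q ^ (i + 1) * d * ((qs q)⁻¹ ^ l)⁻¹ * qc q ^ 2,
    qs q ^ (i + 1) * d * ((qs q)⁻¹ ^ l)⁻¹,
    add_pos (mul_pos (mul_pos (mul_pos hc (inv_pos.2 hwg.1)) (inv_pos.2 hws.1)) hu)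
      (mul_pos (mul_pos (mul_pos hwa.1 hd) (inv_pos.2 hws.1)) (pow_pos (qc_pos q) 2)), ?_⟩
  have e1 : gaStar q * al q ^ i * ga q ^ (j + 1) * gaStar q ^ l =
      u • mon q i (j + 1) (l + 1) := by
    rw [hu', mon, smul_mul_assoc, smul_mul_assoc, mul_assoc (al q ^ i), gaStar_comm_ga_pow,
      pow_succ' (gaStar q)]
    simp only [mul_assoc]
  have e2 : al q ^ (i + 1) * (alStar q * ga q ^ j) * gaStar q ^ l =
      mon q i j l - qc q ^ 2 • mon q i (j + 1) (l + 1) := by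
    have : al q ^ (i + 1) * (alStar q * ga q ^ j) * gaStar q ^ l =
        al q ^ i * (al q * alStar q) * ga q ^ j * gaStar q ^ l := by
      rw [pow_succ]; simp only [mul_assoc]
    rw [this, al_alStar']
    have e3 : al q ^ i * (ga q * gaStar q) * ga q ^ j * gaStar q ^ l =
        mon q i (j + 1) (l + 1) := by
      rw [mon, mul_assoc (al q ^ i), mul_assoc (ga q), gaStar_comm_ga_pow,
        pow_succ' (gaStar q), pow_succ' (ga q)]
      simp only [mul_assoc]
    rw [mul_sub, mul_one, sub_mul, sub_mul, mul_smul_comm, smul_mul_assoc, smul_mul_assoc, e3]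
    rfl
  rw [mon, f_mul, f_mul, f_gaStar_pow, h, h', hwg.2.2, hwa.2.1, hws.2.2]
  simp only [mul_zero, add_zero, neg_mul, smul_mul_smul_comm, add_mul]
  rw [e1, e2]
  module

theorem f_mon_aux_zero (i l : ℕ) : ∃ a : ℂ, 0 < a ∧
    del (fFun q) (mon q (i + 1) 0 l) = -(a • mon q i 0 (l + 1)) := by
  obtain ⟨c, hc, h⟩ := f_al_pow q i
  have hws := (wt_gaStar q).pow l
  obtain ⟨u, hu, hu'⟩ := (pc_al_gaStar q).symm.pow i
  refine ⟨c * ((qs q)⁻¹ ^ l)⁻¹ * u, mul_pos (mul_pos hc (inv_pos.2 hws.1)) hu, ?_⟩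
  have e1 : gaStar q * al q ^ i * gaStar q ^ l = u • mon q i 0 (l + 1) := by
    rw [hu', mon, smul_mul_assoc, pow_succ' (gaStar q), pow_zero, mul_one]
    simp only [mul_assoc]
  rw [mon, pow_zero, mul_one, f_mul, f_gaStar_pow, h, hws.2.2]
  simp only [mul_zero, add_zero, neg_mul, smul_mul_smul_comm]
  rw [e1, smul_smul]

theorem f_mon'_zero (i l : ℕ) : del (fFun q) (mon' q i 0 l) = 0 := by
  simp [mon', f_mul, f_alStar_pow, f_gaStar_pow]

theorem f_mon' (i j l : ℕ) : ∃ c : ℂ, 0 < c ∧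
    del (fFun q) (mon' q i (j + 1) l) = c • mon' q (i + 1) j l := by
  obtain ⟨d, hd, h'⟩ := f_ga_pow q j
  have hwa := (wt_alStar q).pow i
  have hws := (wt_gaStar q).pow l
  refine ⟨(qs q)⁻¹ ^ i * d * ((qs q)⁻¹ ^ l)⁻¹,
    mul_pos (mul_pos hwa.1 hd) (inv_pos.2 hws.1), ?_⟩
  rw [mon', f_mul, f_mul, f_gaStar_pow, f_alStar_pow, h', hwa.2.1, hws.2.2]
  simp only [zero_mul, mul_zero, add_zero, zero_add, smul_mul_smul_comm]
  rw [mon', pow_succ]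
  simp only [mul_assoc]

theorem e_mon'_zero (i j : ℕ) : ∃ c : ℂ, 0 < c ∧
    del (eFun q) (mon' q (i + 1) j 0) = c • mon' q i (j + 1) 0 := by
  obtain ⟨c, hc, h⟩ := e_alStar_pow q i
  have hwg := (wt_ga q).pow j
  obtain ⟨u, hu, hu'⟩ := (pc_ga_alStar q).pow i
  refine ⟨c * (qs q ^ j)⁻¹ * u, mul_pos (mul_pos hc (inv_pos.2 hwg.1)) hu, ?_⟩
  rw [mon', pow_zero, mul_one, e_mul, e_ga_pow, h, hwg.2.2]
  simp only [mul_zero, add_zero, smul_mul_smul_comm]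
  rw [hu', smul_mul_assoc, smul_smul, mon', pow_zero, mul_one, pow_succ' (ga q)]
  simp only [mul_assoc]

theorem e_mon' (i j l : ℕ) : ∃ a b : ℂ, 0 < a ∧
    del (eFun q) (mon' q (i + 1) j (l + 1)) =
      a • mon' q i (j + 1) (l + 1) + b • mon' q i j l := by
  obtain ⟨c, hc, h⟩ := e_alStar_pow q i
  obtain ⟨d, hd, h'⟩ := e_gaStar_pow q l
  have hwa := (wt_alStar q).pow (i + 1)
  have hwg := (wt_ga q).pow j
  have hws := (wt_gaStar q).pow (l + 1)
  have hwag := hwa.mul hwg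
  obtain ⟨u, hu, hu'⟩ := (pc_ga_alStar q).pow i
  obtain ⟨v, hv, hv'⟩ := ((pc_al_ga q).pow j).symm
  have e1 : ga q * alStar q ^ i * ga q ^ j * gaStar q ^ (l + 1) =
      u • mon' q i (j + 1) (l + 1) := by
    rw [hu', mon', smul_mul_assoc, smul_mul_assoc, pow_succ' (ga q)]
    simp only [mul_assoc]
  have e2 : alStar q ^ (i + 1) * ga q ^ j * (al q * gaStar q ^ l) =
      v • (mon' q i j l - mon' q i (j + 1) (l + 1)) := by
    have : alStar q ^ (i + 1) * ga q ^ j * (al q * gaStar q ^ l) =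
        alStar q ^ (i + 1) * (ga q ^ j * al q) * gaStar q ^ l := by simp only [mul_assoc]
    have e3 : alStar q ^ (i + 1) * (al q * ga q ^ j) * gaStar q ^ l =
        alStar q ^ i * (alStar q * al q) * ga q ^ j * gaStar q ^ l := by
      rw [pow_succ]; simp only [mul_assoc]
    have e4 : alStar q ^ i * (ga q * gaStar q) * ga q ^ j * gaStar q ^ l =
        mon' q i (j + 1) (l + 1) := by
      rw [mon', mul_assoc (alStar q ^ i), mul_assoc (ga q), gaStar_comm_ga_pow,
        pow_succ' (gaStar q), pow_succ' (ga q)]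
      simp only [mul_assoc]
    rw [this, hv', mul_smul_comm, smul_mul_assoc, e3, alStar_al', mul_sub, mul_one, sub_mul,
      sub_mul, e4]
    rfl
  refine ⟨c * (qs q ^ j)⁻¹ * ((qs q)⁻¹ ^ (l + 1))⁻¹ * u + (qs q)⁻¹ ^ (i + 1) * qs q ^ j * d * v,
    -((qs q)⁻¹ ^ (i + 1) * qs q ^ j * d * v),
    add_pos (mul_pos (mul_pos (mul_pos hc (inv_pos.2 hwg.1)) (inv_pos.2 hws.1)) hu)
      (mul_pos (mul_pos hwag.1 hd) hv), ?_⟩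
  rw [mon', e_mul, e_mul, e_ga_pow, h, h', hwg.2.2, hwag.2.1, hws.2.2]
  simp only [mul_zero, add_zero, mul_neg, smul_mul_smul_comm]
  rw [e1, e2]
  module

/-- The operator `∂_f ∂_e + ∂_k + ∂_{k⁻¹} - 2`. -/
def tOp : Poly q →ₗ[ℂ] Poly q :=
  del (fFun q) ∘ₗ del (eFun q) + del (kFun q) + del (kInvFun q) - (2 : ℂ) • LinearMap.id

theorem comul_tOp (a : Poly q) : Coalgebra.comul (R := ℂ) (tOp q a) =
    LinearMap.lTensor (Poly q) (tOp q) (Coalgebra.comul (R := ℂ) a) := by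
  simp only [tOp, LinearMap.sub_apply, LinearMap.add_apply, LinearMap.comp_apply, map_sub, map_add,
    comul_del, LinearMap.lTensor_add, LinearMap.lTensor_sub, LinearMap.lTensor_comp,
    LinearMap.lTensor_smul, LinearMap.smul_apply, map_smul, LinearMap.lTensor_id,
    LinearMap.id_apply]

variable {q} in
theorem tOp_of_wt {t c : ℂ} {x y : Poly q} (hx : Wt t x)
    (h : del (fFun q) (del (eFun q) x) = c • x + y) :
    tOp q x = (c + (t + t⁻¹ - 2)) • x + y := by
  simp only [tOp, LinearMap.sub_apply, LinearMap.add_apply, LinearMap.comp_apply, h, hx.2.1, hx.2.2,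
    LinearMap.smul_apply, LinearMap.id_apply]
  module

theorem kappa_eq {t : ℂ} (ht : 0 < t) : t + t⁻¹ - 2 = (1 - t) ^ 2 * t⁻¹ := by
  have := ht.ne'
  field_simp
  ring

theorem kappa_nonneg {t : ℂ} (ht : 0 < t) : 0 ≤ t + t⁻¹ - 2 := by
  rw [kappa_eq ht]
  refine mul_nonneg ?_ (inv_pos.2 ht).le
  lift t to ℝ using (Complex.pos_iff.1 ht).2.symm
  norm_cast
  positivity

theorem tOp_one : tOp q 1 = 0 := by
  have h := tOp_of_wt (wt_one q) (c := 0) (y := 0) (by simp [eFun])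
  rw [h]
  norm_num

/-- Vectors annihilated by `T P(T)` for some polynomial `P` with `P(0) ≠ 0`, which belong to
`ℂ 1 + T(𝓐)`. -/
def good : Submodule ℂ (Poly q) where
  carrier := {v | (∃ P : Polynomial ℂ, P.eval 0 ≠ 0 ∧ Polynomial.aeval (tOp q) P (tOp q v) = 0) ∧
    ∃ (c : ℂ) (w : Poly q), v = c • 1 + tOp q w}
  zero_mem' := ⟨⟨1, by simp, by simp⟩, 0, 0, by simp⟩
  add_mem' := by
    rintro v v' ⟨⟨P, hP, hv⟩, c, w, rfl⟩ ⟨⟨P', hP', hv'⟩, c', w', rfl⟩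
    refine ⟨⟨P * P', by simp [hP, hP'], ?_⟩, c + c', w + w', ?_⟩
    · rw [map_add, map_add]
      nth_rewrite 1 [mul_comm P P']
      rw [map_mul, Module.End.mul_apply, hv, map_mul, Module.End.mul_apply, hv']
      simp
    · rw [map_add]; module
  smul_mem' := by
    rintro z v ⟨⟨P, hP, hv⟩, c, w, rfl⟩
    refine ⟨⟨P, hP, by rw [map_smul, map_smul, hv, smul_zero]⟩, z * c, z • w, ?_⟩
    rw [map_smul]; module

variable {q} in
theorem good_of_eq {c : ℂ} (hc : c ≠ 0) {v w : Poly q} (hw : w ∈ good q)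
    (h : tOp q v = c • v + w) : v ∈ good q := by
  obtain ⟨⟨P, hP, hP'⟩, z, u, hz⟩ := hw
  refine ⟨⟨P * (Polynomial.X - Polynomial.C c), by simp [hP, hc], ?_⟩,
    -(c⁻¹ * z), c⁻¹ • (v - u), ?_⟩
  · have : (Polynomial.aeval (tOp q)) (Polynomial.X - Polynomial.C c) (tOp q v) = tOp q w := by
      have e : w = tOp q v - c • v := by rw [h]; abel
      rw [e]
      simp [Module.algebraMap_end_apply]
    rw [map_mul, Module.End.mul_apply, this, hP']
  · have e : v = c⁻¹ • (tOp q v - w) := by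
      rw [h, add_sub_cancel_right, smul_smul, inv_mul_cancel₀ hc, one_smul]
    rw [map_smul, map_sub]
    nth_rewrite 1 [e]
    rw [hz]
    module

theorem one_good : (1 : Poly q) ∈ good q :=
  ⟨⟨1, by simp, by simp [tOp_one]⟩, 1, 0, by simp⟩

theorem mon_good (l : ℕ) : ∀ i j, mon q i j l ∈ good q := by
  induction l with
  | zero =>
    intro i j
    have hw : Wt (qs q ^ (i + j)) (mon q i j 0) := by
      have := ((wt_al q).pow i).mul ((wt_ga q).pow j)
      rw [← pow_add] at this
      simpa [mon] using this
    by_cases hij : i + j = 0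
    · obtain ⟨rfl, rfl⟩ : i = 0 ∧ j = 0 := by omega
      simpa [mon] using one_good q
    · refine good_of_eq (w := 0) ?_ (good q).zero_mem
        (tOp_of_wt hw (c := 0) (by simp [e_mon_zero]))
      rw [zero_add, kappa_eq hw.1]
      refine mul_ne_zero (pow_ne_zero _ (sub_ne_zero.2 (qs_pow_ne_one q hij).symm))
        (inv_pos.2 hw.1).ne'
  | succ l ih =>
    intro i j
    obtain ⟨t, ht⟩ := wt_mon q i j (l + 1)
    obtain ⟨c, hc, hE⟩ := e_mon q i j l
    cases j with
    | zero =>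
      obtain ⟨a, ha, hF⟩ := f_mon_aux_zero q i l
      refine good_of_eq (w := 0) ?_ (good q).zero_mem
        (tOp_of_wt ht (c := c * a) (by rw [hE, map_neg, map_smul, hF]; module))
      exact (add_pos_of_pos_of_nonneg (mul_pos hc ha) (kappa_nonneg ht.1)).ne'
    | succ j =>
      obtain ⟨a, b, ha, hF⟩ := f_mon_aux q i j l
      refine good_of_eq (w := (-(c * b)) • mon q i j l) ?_ ((good q).smul_mem _ (ih i j))
        (tOp_of_wt ht (c := c * a) (by rw [hE, map_neg, map_smul, hF]; module))
      exact (add_pos_of_pos_of_nonneg (mul_pos hc ha) (kappa_nonneg ht.1)).ne'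

theorem mon'_good (l : ℕ) : ∀ i j, mon' q i j l ∈ good q := by
  induction l with
  | zero =>
    intro i j
    cases i with
    | zero => simpa [mon, mon'] using mon_good q 0 0 j
    | succ i =>
      obtain ⟨t, ht⟩ := wt_mon' q (i + 1) j 0
      obtain ⟨c, hc, hE⟩ := e_mon'_zero q i j
      obtain ⟨a, ha, hF⟩ := f_mon' q i j 0
      refine good_of_eq (w := 0) ?_ (good q).zero_mem
        (tOp_of_wt ht (c := c * a) (by rw [hE, map_smul, hF]; module))
      exact (add_pos_of_pos_of_nonneg (mul_pos hc ha) (kappa_nonneg ht.1)).ne'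
  | succ l ih =>
    intro i j
    cases i with
    | zero => simpa [mon, mon'] using mon_good q (l + 1) 0 j
    | succ i =>
      obtain ⟨t, ht⟩ := wt_mon' q (i + 1) j (l + 1)
      obtain ⟨c, b, hc, hE⟩ := e_mon' q i j l
      obtain ⟨a, ha, hF⟩ := f_mon' q i j (l + 1)
      have hpos := (add_pos_of_pos_of_nonneg (mul_pos hc ha) (kappa_nonneg ht.1)).ne'
      cases j with
      | zero =>
        refine good_of_eq (w := 0) hpos (good q).zero_mem
          (tOp_of_wt ht (by rw [hE, map_add, map_smul, map_smul, hF, f_mon'_zero]; module))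
      | succ j =>
        obtain ⟨a', -, hF'⟩ := f_mon' q i j l
        refine good_of_eq (w := (b * a') • mon' q (i + 1) j l) hpos
          ((good q).smul_mem _ (ih _ _))
          (tOp_of_wt ht (by rw [hE, map_add, map_smul, map_smul, hF, hF']; module))

/-- The span of the monomials. -/
def monSpan : Submodule ℂ (Poly q) :=
  Submodule.span ℂ ({x | ∃ i j l, x = mon q i j l} ∪ {x | ∃ i j l, x = mon' q i j l})

theorem mon_mem (i j l : ℕ) : mon q i j l ∈ monSpan q :=
  Submodule.subset_span (Or.inl ⟨i, j, l, rfl⟩)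

theorem mon'_mem (i j l : ℕ) : mon' q i j l ∈ monSpan q :=
  Submodule.subset_span (Or.inr ⟨i, j, l, rfl⟩)

theorem ga_mon (i j l : ℕ) : ∃ c : ℂ, ga q * mon q i j l = c • mon q i (j + 1) l := by
  obtain ⟨c, -, h⟩ := (pc_al_ga q).symm.pow i
  refine ⟨c, ?_⟩
  rw [mon, ← mul_assoc, ← mul_assoc, h, mon, pow_succ' (ga q)]
  simp only [smul_mul_assoc, mul_assoc]

theorem ga_mon' (i j l : ℕ) : ∃ c : ℂ, ga q * mon' q i j l = c • mon' q i (j + 1) l := by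
  obtain ⟨c, -, h⟩ := (pc_ga_alStar q).pow i
  refine ⟨c, ?_⟩
  rw [mon', ← mul_assoc, ← mul_assoc, h, mon', pow_succ' (ga q)]
  simp only [smul_mul_assoc, mul_assoc]

theorem gaStar_mon (i j l : ℕ) : ∃ c : ℂ, gaStar q * mon q i j l = c • mon q i j (l + 1) := by
  obtain ⟨c, -, h⟩ := (pc_al_gaStar q).symm.pow i
  refine ⟨c, ?_⟩
  rw [mon, ← mul_assoc, ← mul_assoc, h, smul_mul_assoc, mul_assoc (al q ^ i), gaStar_comm_ga_pow,
    mon, pow_succ' (gaStar q)]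
  simp only [smul_mul_assoc, mul_assoc]

theorem gaStar_mon' (i j l : ℕ) : ∃ c : ℂ, gaStar q * mon' q i j l = c • mon' q i j (l + 1) := by
  obtain ⟨c, -, h⟩ := (pc_gaStar_alStar q).pow i
  refine ⟨c, ?_⟩
  rw [mon', ← mul_assoc, ← mul_assoc, h, smul_mul_assoc, mul_assoc (alStar q ^ i),
    gaStar_comm_ga_pow, mon', pow_succ' (gaStar q)]
  simp only [smul_mul_assoc, mul_assoc]

theorem monSpan_mul {a : Poly q} (h : ∀ i j l, a * mon q i j l ∈ monSpan q)
    (h' : ∀ i j l, a * mon' q i j l ∈ monSpan q) : ∀ w ∈ monSpan q, a * w ∈ monSpan q := by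
  intro w hw
  have : monSpan q ≤ (monSpan q).comap (LinearMap.mulLeft ℂ a) := by
    refine Submodule.span_le.2 ?_
    rintro x (⟨i, j, l, rfl⟩ | ⟨i, j, l, rfl⟩)
    · exact h i j l
    · exact h' i j l
  exact this hw

theorem ga_mem : ∀ w ∈ monSpan q, ga q * w ∈ monSpan q := by
  apply monSpan_mul
  · intro i j l
    obtain ⟨c, h⟩ := ga_mon q i j l
    exact h ▸ Submodule.smul_mem _ _ (mon_mem q _ _ _)
  · intro i j l
    obtain ⟨c, h⟩ := ga_mon' q i j l
    exact h ▸ Submodule.smul_mem _ _ (mon'_mem q _ _ _)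

theorem gaStar_mem : ∀ w ∈ monSpan q, gaStar q * w ∈ monSpan q := by
  apply monSpan_mul
  · intro i j l
    obtain ⟨c, h⟩ := gaStar_mon q i j l
    exact h ▸ Submodule.smul_mem _ _ (mon_mem q _ _ _)
  · intro i j l
    obtain ⟨c, h⟩ := gaStar_mon' q i j l
    exact h ▸ Submodule.smul_mem _ _ (mon'_mem q _ _ _)

theorem al_mon (i j l : ℕ) : al q * mon q i j l = mon q (i + 1) j l := by
  rw [mon, mon, pow_succ' (al q)]; simp only [mul_assoc]

theorem alStar_mon' (i j l : ℕ) : alStar q * mon' q i j l = mon' q (i + 1) j l := by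
  rw [mon', mon', pow_succ' (alStar q)]; simp only [mul_assoc]

theorem al_mem : ∀ w ∈ monSpan q, al q * w ∈ monSpan q := by
  apply monSpan_mul
  · intro i j l
    exact al_mon q i j l ▸ mon_mem q _ _ _
  · intro i j l
    cases i with
    | zero =>
      have : mon' q 0 j l = mon q 0 j l := by simp [mon, mon']
      rw [this, al_mon]
      exact mon_mem q _ _ _
    | succ i =>
      rw [← alStar_mon', ← mul_assoc, al_alStar', sub_mul, one_mul, smul_mul_assoc, mul_assoc]
      exact Submodule.sub_mem _ (mon'_mem q _ _ _)
        (Submodule.smul_mem _ _ (ga_mem q _ (gaStar_mem q _ (mon'_mem q _ _ _))))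

theorem alStar_mem : ∀ w ∈ monSpan q, alStar q * w ∈ monSpan q := by
  apply monSpan_mul
  · intro i j l
    cases i with
    | zero =>
      have : mon q 0 j l = mon' q 0 j l := by simp [mon, mon']
      rw [this, alStar_mon']
      exact mon'_mem q _ _ _
    | succ i =>
      rw [← al_mon, ← mul_assoc, alStar_al', sub_mul, one_mul, mul_assoc]
      exact Submodule.sub_mem _ (mon_mem q _ _ _) (ga_mem q _ (gaStar_mem q _ (mon_mem q _ _ _)))
  · intro i j l
    exact alStar_mon' q i j l ▸ mon'_mem q _ _ _

theorem monSpan_eq_top : monSpan q = ⊤ := by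
  let S : Subalgebra ℂ (Poly q) :=
    { carrier := {a | ∀ w ∈ monSpan q, a * w ∈ monSpan q}
      mul_mem' := fun {a b} ha hb w hw => by rw [mul_assoc]; exact ha _ (hb _ hw)
      add_mem' := fun {a b} ha hb w hw => by
        rw [add_mul]; exact Submodule.add_mem _ (ha _ hw) (hb _ hw)
      algebraMap_mem' := fun r w hw => by
        rw [Algebra.algebraMap_eq_smul_one, smul_mul_assoc, one_mul]
        exact Submodule.smul_mem _ _ hw }
  have hS : S = ⊤ := eq_top_of_gen_mem q (al_mem q) (alStar_mem q) (ga_mem q) (gaStar_mem q)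
  rw [eq_top_iff]
  rintro x -
  have hx : x ∈ S := hS ▸ Algebra.mem_top
  have h1 : (1 : Poly q) ∈ monSpan q := by simpa [mon] using mon_mem q 0 0 0
  simpa using hx 1 h1

theorem good_eq_top : good q = ⊤ := by
  rw [eq_top_iff, ← monSpan_eq_top]
  refine Submodule.span_le.2 ?_
  rintro x (⟨i, j, l, rfl⟩ | ⟨i, j, l, rfl⟩)
  · exact mon_good q l i j
  · exact mon'_good q l i j

theorem one_ne_zero' : (1 : Poly q) ≠ 0 := by
  intro h
  have := congrArg (counitHom q) h
  simp at this

theorem one_notMem_range : (1 : Poly q) ∉ LinearMap.range (tOp q) := by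
  rintro ⟨a, ha⟩
  obtain ⟨P, hP, hPa⟩ := (good_eq_top q ▸ Submodule.mem_top : a ∈ good q).1
  rw [ha] at hPa
  have h1 : ∀ P : Polynomial ℂ, Polynomial.aeval (tOp q) P (1 : Poly q) = P.eval 0 • 1 := by
    intro P
    induction P using Polynomial.induction_on with
    | C z => simp [Module.algebraMap_end_apply]
    | add P Q hP hQ => simp [hP, hQ, add_smul]
    | monomial n z _ => simp [pow_succ, tOp_one]
  rw [h1] at hPa
  exact (smul_ne_zero hP (one_ne_zero' q)) hPa

theorem exists_left_invariant : ∃ h : Module.Dual ℂ (Poly q), h 1 = 1 ∧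
    ∀ a, del h a = algebraMap ℂ (Poly q) (h a) := by
  obtain ⟨g, hg, hg'⟩ := Submodule.exists_le_ker_of_notMem (one_notMem_range q)
  let h : Module.Dual ℂ (Poly q) := (g 1)⁻¹ • g
  have h1 : h 1 = 1 := by simp [h, hg]
  have hT : h ∘ₗ tOp q = 0 := by
    ext a
    have : g (tOp q a) = 0 := hg' ⟨a, rfl⟩
    simp [h, this]
  refine ⟨h, h1, fun a => ?_⟩
  obtain ⟨-, c, w, rfl⟩ := (good_eq_top q ▸ Submodule.mem_top : a ∈ good q)
  have e1 : del h (tOp q w) = 0 := by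
    rw [del, LinearMap.comp_apply, comul_tOp, sliceL_lTensor, hT]
    simp [sliceL]
  have e2 : h (tOp q w) = 0 := LinearMap.congr_fun hT w
  simp [e1, e2, h1, Algebra.algebraMap_eq_smul_one]

/-- The automorphism of `𝓐` that transposes the fundamental corepresentation. -/
def transp : Poly q →ₐ[ℂ] Poly q :=
  lift q (al q) (alStar q) (-(qc q • gaStar q)) (-((qc q)⁻¹ • ga q))
    (by simp [smul_smul, qc_ne_zero, ← gaStar_ga, alStar_al q])
    (by simp [smul_smul, qc_ne_zero, ← gaStar_ga, al_alStar q])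
    (by simp [smul_smul, qc_ne_zero, ← gaStar_ga])
    (by simp [al_gaStar, smul_smul])
    (by simp [al_ga, smul_smul, mul_comm])
    (by simp [ga_alStar, smul_smul, mul_comm])
    (by simp [gaStar_alStar, smul_smul])

theorem transp_transp (a : Poly q) : transp q (transp q a) = a := by
  have : (transp q).comp (transp q) = AlgHom.id ℂ _ := by
    apply hom_ext <;> simp [transp, lift_al, lift_alStar, lift_ga, lift_gaStar, smul_smul,
      qc_ne_zero]
  exact AlgHom.congr_fun this a

theorem comul_transp (a : Poly q) : Coalgebra.comul (R := ℂ) (transp q a) =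
    Algebra.TensorProduct.map (transp q) (transp q)
      (Algebra.TensorProduct.comm ℂ (Poly q) (Poly q) (Coalgebra.comul (R := ℂ) a)) := by
  have : (comulHom q).comp (transp q) = (Algebra.TensorProduct.map (transp q) (transp q)).comp
      ((Algebra.TensorProduct.comm ℂ (Poly q) (Poly q)).toAlgHom.comp (comulHom q)) := by
    apply hom_ext <;> simp [comulHom, transp, lift_al, lift_alStar, lift_ga, lift_gaStar, smul_smul,
      qc_ne_zero, TensorProduct.tmul_smul, ← TensorProduct.smul_tmul', TensorProduct.tmul_neg,
      TensorProduct.neg_tmul, add_comm]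
  exact AlgHom.congr_fun this a

theorem exists_isHaar : ∃ h : Module.Dual ℂ (Poly q), IsHaar h := by
  obtain ⟨h, h1, hl⟩ := exists_left_invariant q
  let h' : Module.Dual ℂ (Poly q) := h ∘ₗ (transp q).toLinearMap
  have h1' : h' 1 = 1 := by simp [h', h1]
  have key : ∀ x : Poly q ⊗[ℂ] Poly q, sliceL h (Algebra.TensorProduct.map (transp q) (transp q)
      (Algebra.TensorProduct.comm ℂ (Poly q) (Poly q) x)) = transp q (sliceR h' x) := by
    intro x
    induction x with
    | zero => simp
    | add x y hx hy => simp only [map_add, hx, hy]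
    | tmul u v => simp [h']
  have hr : ∀ a, act h' a = algebraMap ℂ (Poly q) (h' a) := by
    intro a
    have e := hl (transp q a)
    rw [del, LinearMap.comp_apply, comul_transp, key] at e
    have e' := congrArg (transp q) e
    rw [transp_transp, AlgHom.commutes] at e'
    exact e'
  have heq : h = h' := eq_of_invariant q h1 h1' hl hr
  exact ⟨h, h1, hl, fun a => by rw [heq]; exact hr a⟩

end Existence

/-- The Haar state of `SU_q(2)` on `𝓐`. -/
def haar : Module.Dual ℂ (Poly q) := (exists_isHaar q).choose

theorem isHaar_haar : IsHaar (haar q) := (exists_isHaar q).choose_spec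

/-! ### The cochains `τ₁`, `τ₂` and the volume form `τ` -/

/-- `τ₁(b₀, b₁, b₂) = h(b₀ ∂_e(b₁) ∂_f(b₂))`. -/
def tau1 : TwistedCyclic.PreCochain (Sphere q) 2 := fun b =>
  haar q (b 0 * (del (eFun q) (b 1) * del (fFun q) (b 2)))

/-- `τ₂(b₀, b₁, b₂) = h(b₀ ∂_f(b₁) ∂_e(b₂))`. -/
def tau2 : TwistedCyclic.PreCochain (Sphere q) 2 := fun b =>
  haar q (b 0 * (del (fFun q) (b 1) * del (eFun q) (b 2)))

/-- The volume form
`τ(b₀, b₁, b₂) = ∫ b₀ db₁ ∧ db₂ = h(b₀ (q² ∂_e(b₁) ∂_f(b₂) - ∂_f(b₁) ∂_e(b₂)))`. -/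
def tau : TwistedCyclic.PreCochain (Sphere q) 2 := fun b =>
  haar q (b 0 * (qc q ^ 2 • (del (eFun q) (b 1) * del (fFun q) (b 2)) -
    del (fFun q) (b 1) * del (eFun q) (b 2)))

end QuantumSU2

end

/-! Three facts carry the proof.

On `𝓑` the operators `∂_k` and `∂_{k⁻¹}` are the identity, so the twisted Leibniz rules of `∂_e` and
`∂_f` become ordinary ones (`e_mul_sphere`, `f_mul_sphere`), and the relation `(q - q⁻¹)(e f - f e)
= k² - k⁻²` makes the two operators commute there (`e_f_sphere`). Their values on `𝓑` lie in the
eigenspaces of `∂_k` with eigenvalues `q` and `q⁻¹`; this is where the coefficient `q²` of the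
proposition comes from.

The Haar state satisfies `h(∂_ω(a)) = ω(1) h(a)`, hence kills the ranges of `∂_e` and `∂_f` and
permits integration by parts.

The modular automorphism of `h` is `a ↦ ∂_{k²}(a ◁ k²)` (`haar_mul_comm`). On `𝓑` it is `σ`, so `h(x
b) = h(σ(b) x)` for `x ∈ 𝓐` and `b ∈ 𝓑` (`haar_mul_sphere`).

The Leibniz rule and the twisted trace property give `b τ₁ = b τ₂ = 0`. Put `L = ∂_e ∂_f`.
Integration by parts turns `h(∂_e(a) ∂_f(b))` and `h(∂_f(a) ∂_e(b))` into multiples of `h(a L(b)) =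
h(L(a) b)`; as `L` preserves `𝓑` and commutes with `σ`, the two terms of `B τ₁`, and likewise of `B
τ₂`, cancel. Integrating `∂_e(b₀ ∂_f(b₁) b₂)` and `∂_f(b₀ ∂_e(b₁) b₂)` and subtracting, the terms
with `L(b₁)` drop out and what remains is the cyclicity of `τ`. Finally `-q h(b₀ L(b₁))` is a
primitive of `q² τ₁ + τ₂`: its coboundary measures the failure of the Leibniz rule for `L`, which is
`q ∂_e(a) ∂_f(b) + q⁻¹ ∂_f(a) ∂_e(b)`, and `B` kills it. The three cocycles at the end differ by
multiples of this coboundary. -/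

noncomputable section

open scoped TensorProduct

namespace QuantumSU2

variable (q : Set.Ioo (0 : ℝ) 1)

/-! ### Relations of `U_q(su₂)` acting on `𝓐` -/

section Relations

variable {q} in
/-- Induction on the generators of `𝓐`. -/
theorem poly_induction {P : Poly q → Prop} (hal : P (al q)) (halStar : P (alStar q))
    (hga : P (ga q)) (hgaStar : P (gaStar q)) (hone : P 1)
    (hsmul : ∀ (c : ℂ) a, P a → P (c • a)) (hadd : ∀ a b, P a → P b → P (a + b))
    (hmul : ∀ a b, P a → P b → P (a * b)) (a : Poly q) : P a := by
  let S : Subalgebra ℂ (Poly q) :=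
    { carrier := {a | P a}
      mul_mem' := fun {a b} ha hb => hmul a b ha hb
      add_mem' := fun {a b} ha hb => hadd a b ha hb
      algebraMap_mem' := fun r => by
        rw [Algebra.algebraMap_eq_smul_one]
        exact hsmul r 1 hone }
  have hS : S = ⊤ := eq_top_of_gen_mem q hal halStar hga hgaStar
  exact (hS ▸ Algebra.mem_top : a ∈ S)

theorem k_one : del (kFun q) 1 = 1 := by simp [kFun]
theorem kInv_one : del (kInvFun q) 1 = 1 := by simp [kInvFun]
theorem e_one : del (eFun q) 1 = 0 := by simp [eFun]
theorem f_one : del (fFun q) 1 = 0 := by simp [fFun]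

theorem k_kInv (a : Poly q) : del (kFun q) (del (kInvFun q) a) = a := by
  induction a using poly_induction with
  | hal => simp [kInv_al, k_al, smul_smul, qs_ne_zero]
  | halStar => simp [kInv_alStar, k_alStar, smul_smul, qs_ne_zero]
  | hga => simp [kInv_ga, k_ga, smul_smul, qs_ne_zero]
  | hgaStar => simp [kInv_gaStar, k_gaStar, smul_smul, qs_ne_zero]
  | hone => rw [kInv_one, k_one]
  | hsmul c a ha => rw [map_smul, map_smul, ha]
  | hadd a b ha hb => rw [map_add, map_add, ha, hb]
  | hmul a b ha hb => rw [kInv_mul, k_mul, ha, hb]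

theorem kInv_k (a : Poly q) : del (kInvFun q) (del (kFun q) a) = a := by
  induction a using poly_induction with
  | hal => simp [kInv_al, k_al, smul_smul, qs_ne_zero]
  | halStar => simp [kInv_alStar, k_alStar, smul_smul, qs_ne_zero]
  | hga => simp [kInv_ga, k_ga, smul_smul, qs_ne_zero]
  | hgaStar => simp [kInv_gaStar, k_gaStar, smul_smul, qs_ne_zero]
  | hone => rw [k_one, kInv_one]
  | hsmul c a ha => rw [map_smul, map_smul, ha]
  | hadd a b ha hb => rw [map_add, map_add, ha, hb]
  | hmul a b ha hb => rw [k_mul, kInv_mul, ha, hb]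

/-- `k e = q e k`. -/
theorem k_e (a : Poly q) :
    del (kFun q) (del (eFun q) a) = qc q • del (eFun q) (del (kFun q) a) := by
  have hs := qs_ne_zero q
  induction a using poly_induction with
  | hal => simp [k_al, e_al]
  | halStar => simp [k_alStar, e_alStar, k_ga, smul_smul, ← qs_mul_self, hs]
  | hga => simp [k_ga, e_ga]
  | hgaStar =>
    simp [k_gaStar, e_gaStar, k_al, smul_smul, ← qs_mul_self]
    congr 1
    field_simp
  | hone => rw [k_one, e_one, map_zero, smul_zero]
  | hsmul c a ha => simp only [map_smul, ha, smul_comm c]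
  | hadd a b ha hb => simp only [map_add, ha, hb, smul_add]
  | hmul a b ha hb =>
    simp only [k_mul, e_mul, map_add, ha, hb, k_kInv, kInv_k, smul_add, smul_mul_assoc,
      mul_smul_comm]

/-- `k f = q⁻¹ f k`. -/
theorem k_f (a : Poly q) :
    del (kFun q) (del (fFun q) a) = (qc q)⁻¹ • del (fFun q) (del (kFun q) a) := by
  have hs := qs_ne_zero q
  induction a using poly_induction with
  | hal =>
    simp [k_al, f_al, k_gaStar, smul_smul, ← qs_mul_self]
    congr 1
    field_simp
  | halStar => simp [k_alStar, f_alStar]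
  | hga => simp [k_ga, f_ga, k_alStar, smul_smul, ← qs_mul_self, hs]
  | hgaStar => simp [k_gaStar, f_gaStar]
  | hone => rw [k_one, f_one, map_zero, smul_zero]
  | hsmul c a ha => simp only [map_smul, ha, smul_comm c]
  | hadd a b ha hb => simp only [map_add, ha, hb, smul_add]
  | hmul a b ha hb =>
    simp only [k_mul, f_mul, map_add, ha, hb, k_kInv, kInv_k, smul_add, smul_mul_assoc,
      mul_smul_comm]

/-- Conjugating `k e = q e k` by `k⁻¹`; this is the form needed in the right-hand factor of the
twisted Leibniz rule. -/
theorem e_kInv (a : Poly q) :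
    del (eFun q) (del (kInvFun q) a) = qc q • del (kInvFun q) (del (eFun q) a) := by
  have h := congrArg (del (kInvFun q)) (k_e q (del (kInvFun q) a))
  rwa [kInv_k, k_kInv, map_smul] at h

theorem f_kInv (a : Poly q) :
    del (fFun q) (del (kInvFun q) a) = (qc q)⁻¹ • del (kInvFun q) (del (fFun q) a) := by
  have h := congrArg (del (kInvFun q)) (k_f q (del (kInvFun q) a))
  rwa [kInv_k, k_kInv, map_smul] at h

/-- `(q - q⁻¹) (e f - f e) = k² - k⁻²`. -/
theorem e_f_sub_f_e (a : Poly q) :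
    (qc q - (qc q)⁻¹) • (del (eFun q) (del (fFun q) a) - del (fFun q) (del (eFun q) a)) =
      del (kFun q) (del (kFun q) a) - del (kInvFun q) (del (kInvFun q) a) := by
  have hs := qs_ne_zero q
  induction a using poly_induction with
  | hal =>
    simp [e_al, f_al, e_gaStar, k_al, kInv_al, smul_smul, ← qs_mul_self]
    match_scalars
    field_simp
  | halStar =>
    simp [e_alStar, f_alStar, f_ga, k_alStar, kInv_alStar, smul_smul, ← qs_mul_self, sub_smul]
  | hga =>
    simp [e_ga, f_ga, e_alStar, k_ga, kInv_ga, smul_smul, ← qs_mul_self, sub_smul]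
  | hgaStar =>
    simp [e_gaStar, f_gaStar, f_al, k_gaStar, kInv_gaStar, smul_smul, ← qs_mul_self]
    match_scalars
    field_simp
    ring
  | hone => simp only [k_one, kInv_one, e_one, f_one, map_zero, sub_self, smul_zero]
  | hsmul c a ha => simp only [map_smul, ← smul_sub, ← ha, smul_comm c]
  | hadd a b ha hb =>
    have e : ∀ x y z w : Poly q, x + y - (z + w) = x - z + (y - w) := by intros; abel
    simp only [map_add, e, ← ha, ← hb, smul_add]
  | hmul a b ha hb =>
    -- The mixed terms cancel because the factors `q` and `q⁻¹` from moving `k^{±1}` past `e` and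
    -- `f` compensate. The commutator thus obeys the Leibniz rule twisted by `k²` and `k⁻²`, which
    -- `k² - k⁻²` obeys as well.
    have key : del (eFun q) (del (fFun q) (a * b)) - del (fFun q) (del (eFun q) (a * b)) =
        (del (eFun q) (del (fFun q) a) - del (fFun q) (del (eFun q) a)) *
          del (kInvFun q) (del (kInvFun q) b) +
        del (kFun q) (del (kFun q) a) *
          (del (eFun q) (del (fFun q) b) - del (fFun q) (del (eFun q) b)) := by
      simp only [e_mul, f_mul, map_add, k_e, k_f, e_kInv, f_kInv, smul_mul_assoc, mul_smul_comm,
        sub_mul, mul_sub, smul_smul, mul_inv_cancel₀ (qc_ne_zero q), one_smul,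
        inv_mul_cancel₀ (qc_ne_zero q)]
      module
    rw [key, smul_add, ← smul_mul_assoc, ha, ← mul_smul_comm, hb]
    simp only [k_mul, kInv_mul, sub_mul, mul_sub]
    abel

theorem qc_sub_inv_ne_zero : qc q - (qc q)⁻¹ ≠ 0 := by
  intro h
  have h1 : qc q * qc q = 1 := by
    rw [sub_eq_zero] at h
    nth_rewrite 2 [h]
    exact mul_inv_cancel₀ (qc_ne_zero q)
  -- The exponent is four because `q² = (q^{1/2})⁴`.
  have := qs_pow_ne_one q (n := 4) (by norm_num)
  apply this
  rw [← h1, ← qs_mul_self]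
  ring

end Relations

/-! ### Invariance and the modular automorphism of the Haar state -/

section Modular

/-- Both sides are `(h ⊗ φ)Δ(a)`: slicing by `h` first gives `h(a) 1` by invariance. This is the
source of all integrations by parts. -/
theorem haar_del (φ : Module.Dual ℂ (Poly q)) (a : Poly q) : haar q (del φ a) = φ 1 * haar q a := by
  rw [del, LinearMap.comp_apply, apply_sliceL]
  have := (isHaar_haar q).right_inv a
  rw [act, LinearMap.comp_apply] at this
  rw [this, Algebra.algebraMap_eq_smul_one, map_smul, smul_eq_mul, mul_comm]

theorem haar_act (φ : Module.Dual ℂ (Poly q)) (a : Poly q) : haar q (act φ a) = φ 1 * haar q a := by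
  rw [act, LinearMap.comp_apply, ← apply_sliceL]
  have := (isHaar_haar q).left_inv a
  rw [del, LinearMap.comp_apply] at this
  rw [this, Algebra.algebraMap_eq_smul_one, map_smul, smul_eq_mul, mul_comm]

theorem haar_k (a : Poly q) : haar q (del (kFun q) a) = haar q a := by
  simp [haar_del, kFun]

theorem haar_kInv (a : Poly q) : haar q (del (kInvFun q) a) = haar q a := by
  simp [haar_del, kInvFun]

theorem haar_e (a : Poly q) : haar q (del (eFun q) a) = 0 := by
  simp [haar_del, eFun]

theorem haar_f (a : Poly q) : haar q (del (fFun q) a) = 0 := by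
  simp [haar_del, fFun]

theorem act_al (φ : Module.Dual ℂ (Poly q)) :
    act φ (al q) = φ (al q) • al q - (qc q * φ (gaStar q)) • ga q := by
  have : Coalgebra.comul (R := ℂ) (al q) = al q ⊗ₜ al q - qc q • (gaStar q ⊗ₜ ga q) :=
    lift_al ..
  simp [act, this, smul_smul]

theorem act_alStar (φ : Module.Dual ℂ (Poly q)) :
    act φ (alStar q) = φ (alStar q) • alStar q - (qc q * φ (ga q)) • gaStar q := by
  have : Coalgebra.comul (R := ℂ) (alStar q) =
      alStar q ⊗ₜ alStar q - qc q • (ga q ⊗ₜ gaStar q) := lift_alStar ..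
  simp [act, this, smul_smul]

theorem act_ga (φ : Module.Dual ℂ (Poly q)) :
    act φ (ga q) = φ (ga q) • al q + φ (alStar q) • ga q := by
  have : Coalgebra.comul (R := ℂ) (ga q) = ga q ⊗ₜ al q + alStar q ⊗ₜ ga q := lift_ga ..
  simp [act, this]

theorem act_gaStar (φ : Module.Dual ℂ (Poly q)) :
    act φ (gaStar q) = φ (gaStar q) • alStar q + φ (al q) • gaStar q := by
  have : Coalgebra.comul (R := ℂ) (gaStar q) = gaStar q ⊗ₜ alStar q + al q ⊗ₜ gaStar q :=
    lift_gaStar ..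
  simp [act, this]

theorem rhoHom_al : rhoHom q (al q) = qc q := by
  have : Coalgebra.comul (R := ℂ) (al q) = al q ⊗ₜ al q - qc q • (gaStar q ⊗ₜ ga q) :=
    lift_al ..
  simp [rhoHom, this, kHom, lift_al, lift_ga, qs_mul_self]

theorem rhoHom_alStar : rhoHom q (alStar q) = (qc q)⁻¹ := by
  have : Coalgebra.comul (R := ℂ) (alStar q) =
      alStar q ⊗ₜ alStar q - qc q • (ga q ⊗ₜ gaStar q) := lift_alStar ..
  simp [rhoHom, this, kHom, lift_alStar, lift_ga, ← qs_mul_self]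

theorem rhoHom_ga : rhoHom q (ga q) = 0 := by
  have : Coalgebra.comul (R := ℂ) (ga q) = ga q ⊗ₜ al q + alStar q ⊗ₜ ga q := lift_ga ..
  simp [rhoHom, this, kHom, lift_ga]

theorem rhoHom_gaStar : rhoHom q (gaStar q) = 0 := by
  have : Coalgebra.comul (R := ℂ) (gaStar q) = gaStar q ⊗ₜ alStar q + al q ⊗ₜ gaStar q :=
    lift_gaStar ..
  simp [rhoHom, this, kHom, lift_gaStar]

/-- The modular automorphism `a ↦ ∂_{k²}(a ◁ k²)` of the Haar state. -/
def modular : Poly q →ₐ[ℂ] Poly q :=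
  AlgHom.ofLinearMap (del (kFun q) ∘ₗ del (kFun q) ∘ₗ act (rhoHom q).toLinearMap)
    (by simp only [LinearMap.comp_apply, act_one]; simp [k_one, -del_one])
    (fun a b => by simp only [LinearMap.comp_apply, act_char_mul, k_mul])

theorem modular_apply (a : Poly q) :
    modular q a = del (kFun q) (del (kFun q) (act (rhoHom q).toLinearMap a)) := rfl

theorem modular_al : modular q (al q) = qc q ^ 2 • al q := by
  simp [modular_apply, act_al, rhoHom_al, rhoHom_gaStar, k_al, smul_smul, ← qs_mul_self]
  ring_nf

theorem modular_alStar : modular q (alStar q) = (qc q ^ 2)⁻¹ • alStar q := by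
  simp [modular_apply, act_alStar, rhoHom_alStar, rhoHom_ga, k_alStar, smul_smul, ← qs_mul_self]
  ring_nf

theorem modular_ga : modular q (ga q) = ga q := by
  simp [modular_apply, act_ga, rhoHom_alStar, rhoHom_ga, k_ga, smul_smul, ← qs_mul_self,
    qs_ne_zero]

theorem modular_gaStar : modular q (gaStar q) = gaStar q := by
  simp [modular_apply, act_gaStar, rhoHom_al, rhoHom_gaStar, k_gaStar, smul_smul, ← qs_mul_self,
    qs_ne_zero]

theorem haar_modular (a : Poly q) : haar q (modular q a) = haar q a := by
  simp [modular_apply, haar_k, haar_act]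

/-- The candidate modular automorphism preserves `h` and scales this monomial by `q^{2i}`, which is
not `1`. -/
theorem haar_mon_eq_zero {i : ℕ} (hi : i ≠ 0) (j l : ℕ) : haar q (mon q i j l) = 0 := by
  have h := haar_modular q (mon q i j l)
  simp only [mon, map_mul, map_pow, modular_al, modular_ga, modular_gaStar, smul_pow,
    smul_mul_assoc, map_smul, smul_eq_mul] at h
  by_contra h0
  have h1 := mul_right_cancel₀ h0 (h.trans (one_mul _).symm)
  -- In terms of `q^{1/2}` the scaling factor `q^{2i}` has exponent `4i`.
  refine qs_pow_ne_one q (n := 4 * i) (by omega) ?_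
  rw [← h1, ← qs_mul_self]
  ring

theorem haar_mon'_eq_zero {i : ℕ} (hi : i ≠ 0) (j l : ℕ) : haar q (mon' q i j l) = 0 := by
  have h := haar_modular q (mon' q i j l)
  simp only [mon', map_mul, map_pow, modular_alStar, modular_ga, modular_gaStar, smul_pow,
    smul_mul_assoc, map_smul, smul_eq_mul] at h
  by_contra h0
  have h1 := mul_right_cancel₀ h0 (h.trans (one_mul _).symm)
  rw [inv_pow, inv_eq_one] at h1
  refine qs_pow_ne_one q (n := 4 * i) (by omega) ?_
  rw [← h1, ← qs_mul_self]
  ring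

theorem mon_mul_gaStar (i j l : ℕ) : mon q i j l * gaStar q = mon q i j (l + 1) := by
  rw [mon, mon, pow_succ (gaStar q)]; simp only [mul_assoc]

theorem mon'_mul_gaStar (i j l : ℕ) : mon' q i j l * gaStar q = mon' q i j (l + 1) := by
  rw [mon', mon', pow_succ (gaStar q)]; simp only [mul_assoc]

theorem gaStar_pow_mul_ga (l : ℕ) : gaStar q ^ l * ga q = ga q * gaStar q ^ l :=
  (Commute.pow_left (show Commute (gaStar q) (ga q) from gaStar_ga q) l).eq

theorem mon_mul_ga (i j l : ℕ) : mon q i j l * ga q = mon q i (j + 1) l := by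
  rw [mon, mon, pow_succ (ga q), mul_assoc _ (gaStar q ^ l), gaStar_pow_mul_ga]
  simp only [mul_assoc]

theorem mon'_mul_ga (i j l : ℕ) : mon' q i j l * ga q = mon' q i (j + 1) l := by
  rw [mon', mon', pow_succ (ga q), mul_assoc _ (gaStar q ^ l), gaStar_pow_mul_ga]
  simp only [mul_assoc]

theorem mon'_zero (j l : ℕ) : mon' q 0 j l = mon q 0 j l := by simp [mon, mon']

theorem ga_mul_mon_zero (j l : ℕ) : ga q * mon q 0 j l = mon q 0 (j + 1) l := by
  simp [mon, pow_succ', mul_assoc]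

theorem gaStar_mul_mon_zero (j l : ℕ) : gaStar q * mon q 0 j l = mon q 0 j (l + 1) := by
  simp only [mon, pow_zero, one_mul, pow_succ' (gaStar q), ← mul_assoc, gaStar_comm_ga_pow]

-- The two families of monomials overlap at `i = 0`; leaving these out of the second family means
-- that only monomials killed by `h` remain there.
variable {q} in
theorem linearMap_eq_of_mon {φ ψ : Module.Dual ℂ (Poly q)}
    (h : ∀ i j l, φ (mon q i j l) = ψ (mon q i j l))
    (h' : ∀ i j l, i ≠ 0 → φ (mon' q i j l) = ψ (mon' q i j l)) : φ = ψ := by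
  refine LinearMap.ext_on (monSpan_eq_top q) ?_
  rintro x (⟨i, j, l, rfl⟩ | ⟨i, j, l, rfl⟩)
  · exact h i j l
  · rcases eq_or_ne i 0 with rfl | hi
    · rw [mon'_zero]; exact h 0 j l
    · exact h' i j l hi

/-- On monomials in `γ, γ^*` alone everything commutes. If a power of `α` or `α^*` occurs,
multiplying by `γ` on either side leaves it there, so both values vanish. -/
theorem haar_mul_ga (x : Poly q) : haar q (x * ga q) = haar q (ga q * x) := by
  refine LinearMap.congr_fun (f := haar q ∘ₗ LinearMap.mulRight ℂ (ga q))
    (g := haar q ∘ₗ LinearMap.mulLeft ℂ (ga q)) (linearMap_eq_of_mon ?_ ?_) x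
  · intro i j l
    simp only [LinearMap.comp_apply, LinearMap.mulRight_apply, LinearMap.mulLeft_apply, mon_mul_ga]
    rcases eq_or_ne i 0 with rfl | hi
    · rw [ga_mul_mon_zero]
    · obtain ⟨c, hc⟩ := ga_mon q i j l
      rw [hc, map_smul, haar_mon_eq_zero q hi, smul_zero]
  · intro i j l hi
    simp only [LinearMap.comp_apply, LinearMap.mulRight_apply, LinearMap.mulLeft_apply, mon'_mul_ga]
    obtain ⟨c, hc⟩ := ga_mon' q i j l
    rw [hc, map_smul, haar_mon'_eq_zero q hi, smul_zero]

theorem haar_mul_gaStar (x : Poly q) : haar q (x * gaStar q) = haar q (gaStar q * x) := by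
  refine LinearMap.congr_fun (f := haar q ∘ₗ LinearMap.mulRight ℂ (gaStar q))
    (g := haar q ∘ₗ LinearMap.mulLeft ℂ (gaStar q)) (linearMap_eq_of_mon ?_ ?_) x
  · intro i j l
    simp only [LinearMap.comp_apply, LinearMap.mulRight_apply, LinearMap.mulLeft_apply,
      mon_mul_gaStar]
    rcases eq_or_ne i 0 with rfl | hi
    · rw [gaStar_mul_mon_zero]
    · obtain ⟨c, hc⟩ := gaStar_mon q i j l
      rw [hc, map_smul, haar_mon_eq_zero q hi, smul_zero]
  · intro i j l hi
    simp only [LinearMap.comp_apply, LinearMap.mulRight_apply, LinearMap.mulLeft_apply,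
      mon'_mul_gaStar]
    obtain ⟨c, hc⟩ := gaStar_mon' q i j l
    rw [hc, map_smul, haar_mon'_eq_zero q hi, smul_zero]

/-- Since `∂_e(γ^*) = -q⁻¹ α`, the rule for `α` follows from the one for `γ^*`: integrating `∂_e(y
γ^*)` and `∂_e(γ^* y)` expresses `h(y α)` and `h(α y)` through `h(∂_e(y) γ^*) = h(γ^* ∂_e(y))`. The
rule for `α^*` comes in the same way from `∂_f(γ) = α^*`. -/
theorem haar_mul_al (y : Poly q) : haar q (y * al q) = qc q ^ 2 * haar q (al q * y) := by
  have hs := qs_ne_zero q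
  have h1 := haar_e q (y * gaStar q)
  have h2 := haar_e q (gaStar q * y)
  have h3 := haar_k q (y * al q)
  have h4 := haar_kInv q (al q * y)
  have h5 := haar_mul_gaStar q (del (eFun q) y)
  simp only [e_mul, k_mul, kInv_mul, e_gaStar, k_al, kInv_al, k_gaStar, kInv_gaStar, map_add,
    map_smul, mul_smul_comm, smul_mul_assoc, smul_eq_mul, mul_neg, neg_mul, map_neg] at h1 h2 h3 h4
  -- Invariance under `k^{±1}` replaces `y` by `∂_k(y)` and `∂_{k⁻¹}(y)`, the forms in which it
  -- occurs in the integrated Leibniz rules.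
  rw [← h3, ← h4]
  rw [h5] at h1
  rw [← qs_mul_self] at *
  field_simp at h1 h2 ⊢
  linear_combination (-1 : ℂ) * h1 + qs q ^ 2 * h2

theorem haar_mul_alStar (y : Poly q) :
    haar q (y * alStar q) = (qc q ^ 2)⁻¹ * haar q (alStar q * y) := by
  have hs := qs_ne_zero q
  have h1 := haar_f q (y * ga q)
  have h2 := haar_f q (ga q * y)
  have h3 := haar_k q (y * alStar q)
  have h4 := haar_kInv q (alStar q * y)
  have h5 := haar_mul_ga q (del (fFun q) y)
  simp only [f_mul, k_mul, kInv_mul, f_ga, k_alStar, kInv_alStar, k_ga, kInv_ga, map_add,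
    map_smul, mul_smul_comm, smul_mul_assoc, smul_eq_mul] at h1 h2 h3 h4
  rw [← h3, ← h4]
  rw [h5] at h1
  rw [← qs_mul_self] at *
  field_simp at h1 h2 ⊢
  linear_combination qs q * h1 - h2

/-- The modular property of the Haar state. -/
theorem haar_mul_comm (x y : Poly q) : haar q (x * y) = haar q (modular q y * x) := by
  -- The factors of a product are moved around one at a time, `h(x a b) = h(θ(b) x a) = h(θ(a) θ(b)
  -- x)` with `θ` the modular automorphism, so `x` must vary.
  induction y using poly_induction generalizing x with
  | hal => rw [haar_mul_al, modular_al, smul_mul_assoc, map_smul, smul_eq_mul]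
  | halStar => rw [haar_mul_alStar, modular_alStar, smul_mul_assoc, map_smul, smul_eq_mul]
  | hga => rw [haar_mul_ga, modular_ga]
  | hgaStar => rw [haar_mul_gaStar, modular_gaStar]
  | hone => simp
  | hsmul c a ha => simp only [map_smul, mul_smul_comm, smul_mul_assoc, ha]
  | hadd a b ha hb => simp only [map_add, mul_add, add_mul, ha, hb]
  | hmul a b ha hb => rw [← mul_assoc, hb, ← mul_assoc, ha, map_mul (modular q), mul_assoc]

end Modular

/-! ### The derivations `∂_e`, `∂_f` and the twisted trace on the quantum sphere -/

section SphereCalculus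

variable {q}

theorem k_sphere (b : Sphere q) : del (kFun q) (b : Poly q) = b := b.2

theorem kInv_sphere (b : Sphere q) : del (kInvFun q) (b : Poly q) = b := by
  conv_lhs => rw [← k_sphere b]
  exact kInv_k q _

theorem coe_twist (b : Sphere q) :
    (twist q b : Poly q) = act (rhoHom q).toLinearMap (b : Poly q) := rfl

/-- The factor `∂_{k²}` of the modular automorphism is trivial on `𝓑`, which leaves `σ`. It matters
that `x` ranges over all of `𝓐`, as `∂_e` and `∂_f` do not preserve `𝓑`. -/
theorem haar_mul_sphere (x : Poly q) (b : Sphere q) :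
    haar q (x * b) = haar q ((twist q b : Poly q) * x) := by
  rw [haar_mul_comm, modular_apply, ← coe_twist, k_sphere, k_sphere]

/-- Both `k²` and `k⁻²` fix `b`, so the commutator relation has right-hand side zero, while `q - q⁻¹
≠ 0`. -/
theorem e_f_sphere (b : Sphere q) :
    del (eFun q) (del (fFun q) (b : Poly q)) = del (fFun q) (del (eFun q) (b : Poly q)) := by
  have h := e_f_sub_f_e q (b : Poly q)
  simp only [k_sphere, kInv_sphere, sub_self] at h
  exact sub_eq_zero.1 ((smul_eq_zero.1 h).resolve_left (qc_sub_inv_ne_zero q))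

theorem k_e_sphere (b : Sphere q) :
    del (kFun q) (del (eFun q) (b : Poly q)) = qc q • del (eFun q) (b : Poly q) := by
  rw [k_e, k_sphere]

theorem k_f_sphere (b : Sphere q) :
    del (kFun q) (del (fFun q) (b : Poly q)) = (qc q)⁻¹ • del (fFun q) (b : Poly q) := by
  rw [k_f, k_sphere]

theorem kInv_e_sphere (b : Sphere q) :
    del (kInvFun q) (del (eFun q) (b : Poly q)) = (qc q)⁻¹ • del (eFun q) (b : Poly q) := by
  have h := e_kInv q (b : Poly q)
  rw [kInv_sphere] at h
  nth_rewrite 2 [h]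
  rw [smul_smul, inv_mul_cancel₀ (qc_ne_zero q), one_smul]

theorem kInv_f_sphere (b : Sphere q) :
    del (kInvFun q) (del (fFun q) (b : Poly q)) = qc q • del (fFun q) (b : Poly q) := by
  have h := f_kInv q (b : Poly q)
  rw [kInv_sphere] at h
  nth_rewrite 2 [h]
  rw [smul_smul, mul_inv_cancel₀ (qc_ne_zero q), one_smul]

theorem e_mul_sphere (a b : Sphere q) : del (eFun q) ((a : Poly q) * b) =
    del (eFun q) (a : Poly q) * b + a * del (eFun q) (b : Poly q) := by
  rw [e_mul, k_sphere, kInv_sphere]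

theorem f_mul_sphere (a b : Sphere q) : del (fFun q) ((a : Poly q) * b) =
    del (fFun q) (a : Poly q) * b + a * del (fFun q) (b : Poly q) := by
  rw [f_mul, k_sphere, kInv_sphere]

/-- The weights `q` of `e` and `q⁻¹` of `f` cancel. -/
theorem e_f_mem_sphere (b : Sphere q) : del (eFun q) (del (fFun q) (b : Poly q)) ∈ Sphere q := by
  show del (kFun q) _ = _
  rw [k_e, k_f_sphere, map_smul, smul_smul, mul_inv_cancel₀ (qc_ne_zero q), one_smul]

/-- The twisted trace property applies to `∂_e ∂_f(b) ∈ 𝓑`, and the twist passes inside because left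
and right actions commute. -/
theorem haar_mul_e_f (x : Poly q) (b : Sphere q) :
    haar q (x * del (eFun q) (del (fFun q) (b : Poly q))) =
      haar q (del (eFun q) (del (fFun q) (twist q b : Poly q)) * x) := by
  have h := haar_mul_sphere x ⟨_, e_f_mem_sphere b⟩
  simp only [coe_twist] at h ⊢
  rw [h, del_act, del_act]

end SphereCalculus

end QuantumSU2

/-! ### Cochains concentrated in one degree, and the operators in low degrees -/

namespace TwistedCyclic

theorem single_same {B : Type*} (n : ℕ) (f : PreCochain B n) : single n f n = f := Pi.single_eq_same n f

theorem single_of_ne {B : Type*} {m n : ℕ} (h : m ≠ n) (f : PreCochain B n) : single n f m = 0 :=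
  Pi.single_eq_of_ne h f

theorem single_zero {B : Type*} (n : ℕ) : single n (0 : PreCochain B n) = 0 := Pi.single_zero n

theorem single_sub {B : Type*} (n : ℕ) (f g : PreCochain B n) :
    single n (f - g) = single n f - single n g := Pi.single_sub n f g

theorem bZeroOp_zero_apply {B : Type*} [Ring B] (f : PreCochain B 1) (b : Fin 1 → B) :
    bZeroOp 0 f b = f ![1, b 0] + f ![b 0, 1] := by
  have e1 : (Fin.cons (1 : B) b : Fin 2 → B) = ![1, b 0] := by ext i; fin_cases i <;> rfl
  have e2 : (Fin.snoc b (1 : B) : Fin 2 → B) = ![b 0, 1] := by ext i; fin_cases i <;> rfl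
  rw [bZeroOp, e1, e2]
  ring

theorem bZeroOp_one_apply {B : Type*} [Ring B] (f : PreCochain B 2) (b : Fin 2 → B) :
    bZeroOp 1 f b = f ![1, b 0, b 1] - f ![b 0, b 1, 1] := by
  have e1 : (Fin.cons (1 : B) b : Fin 3 → B) = ![1, b 0, b 1] := by ext i; fin_cases i <;> rfl
  have e2 : (Fin.snoc b (1 : B) : Fin 3 → B) = ![b 0, b 1, 1] := by ext i; fin_cases i <;> rfl
  rw [bZeroOp, e1, e2]
  ring

variable {B : Type*} [Ring B] [Algebra ℂ B] (σ : B →ₐ[ℂ] B)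

theorem bOp_add (n : ℕ) (f g : PreCochain B n) : bOp σ n (f + g) = bOp σ n f + bOp σ n g := by
  ext b
  simp only [bOp, Pi.add_apply, mul_add, Finset.sum_add_distrib]
  ring

theorem bOp_smul (n : ℕ) (c : ℂ) (f : PreCochain B n) : bOp σ n (c • f) = c • bOp σ n f := by
  ext b
  simp only [bOp, Pi.smul_apply, smul_eq_mul, mul_add, Finset.mul_sum, mul_left_comm c]

/-- The cyclic operator as a linear map. -/
def lambdaLin (n : ℕ) : Module.End ℂ (PreCochain B n) where
  toFun := lambdaOp σ n
  map_add' f g := by ext b; simp only [lambdaOp, Pi.add_apply, mul_add]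
  map_smul' c f := by
    ext b; simp only [lambdaOp, Pi.smul_apply, smul_eq_mul, mul_left_comm c, RingHom.id_apply]

/-- As a polynomial in an endomorphism, `N` is visibly linear; `B` inherits this. -/
theorem nOp_eq (n : ℕ) (f : PreCochain B n) :
    nOp σ n f = (∑ i ∈ Finset.range (n + 1), lambdaLin σ n ^ i) f := by
  simp only [nOp, LinearMap.sum_apply, Module.End.pow_apply]
  rfl

theorem bigBOp_add (n : ℕ) (f g : PreCochain B (n + 1)) :
    bigBOp σ n (f + g) = bigBOp σ n f + bigBOp σ n g := by
  have : bZeroOp n (f + g) = bZeroOp n f + bZeroOp n g := by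
    ext b
    simp only [bZeroOp, Pi.add_apply]
    ring
  rw [bigBOp, this, nOp_eq, map_add, ← nOp_eq, ← nOp_eq, bigBOp, bigBOp]

theorem bigBOp_smul (n : ℕ) (c : ℂ) (f : PreCochain B (n + 1)) :
    bigBOp σ n (c • f) = c • bigBOp σ n f := by
  have : bZeroOp n (c • f) = c • bZeroOp n f := by
    ext b
    simp only [bZeroOp, Pi.smul_apply, smul_eq_mul]
    ring
  rw [bigBOp, this, nOp_eq, map_smul, ← nOp_eq, bigBOp]

theorem bOp_zero (n : ℕ) : bOp σ n 0 = 0 := by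
  simpa using bOp_smul σ n 0 0

theorem bigBOp_zero (n : ℕ) : bigBOp σ n 0 = 0 := by
  simpa using bigBOp_smul σ n 0 0

/-- `b + B` on a cochain of positive degree. -/
theorem bPlusB_single (n : ℕ) (f : PreCochain B (n + 1)) :
    bPlusB σ (single (n + 1) f) = single (n + 2) (bOp σ (n + 1) f) + single n (bigBOp σ n f) := by
  funext m
  rw [Pi.add_apply]
  cases m with
  | zero =>
    rw [single_of_ne (by omega), zero_add, bPlusB]
    rcases eq_or_ne n 0 with rfl | h
    · rw [single_same, single_same]
    · rw [single_of_ne (by omega), single_of_ne (by omega), bigBOp_zero]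
  | succ m =>
    rw [bPlusB]
    congr 1
    · rcases eq_or_ne m (n + 1) with rfl | h
      · rw [single_same, single_same]
      · rw [single_of_ne h, single_of_ne (by omega), bOp_zero]
    · rcases eq_or_ne n (m + 1) with rfl | h
      · rw [single_same, single_same]
      · rw [single_of_ne (by omega), single_of_ne (by omega), bigBOp_zero]

variable {σ}

theorem single_mem_totalCochains {n : ℕ} {k : ZMod 2} (hn : (n : ZMod 2) = k)
    {f : PreCochain B n} (hf : f ∈ cochains σ n) : single n f ∈ totalCochains σ k := by
  refine ⟨fun m => ?_, (Set.finite_singleton n).subset ?_, ?_⟩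
  · rcases eq_or_ne m n with rfl | h
    · rwa [single_same]
    · rw [single_of_ne h]
      exact (cochains σ m).zero_mem
  · intro m hm
    by_contra h
    exact hm (single_of_ne h f)
  · rintro m hm
    refine single_of_ne ?_ f
    rintro rfl
    exact hm hn

theorem isTotalCocycle_single {n : ℕ} {k : ZMod 2} (hn : ((n + 1 : ℕ) : ZMod 2) = k)
    {f : PreCochain B (n + 1)} (hf : f ∈ cochains σ (n + 1)) (hb : bOp σ (n + 1) f = 0)
    (hB : bigBOp σ n f = 0) : IsTotalCocycle σ k (single (n + 1) f) := by
  refine ⟨single_mem_totalCochains hn hf, ?_⟩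
  rw [bPlusB_single, hb, hB, single_zero, single_zero, add_zero]

/-- A primitive for `b` is one for `b + B` as soon as `B` kills it, since no component of lower
degree then appears. -/
theorem isTotalCoboundary_single {n : ℕ} {k : ZMod 2} (hn : ((n + 2 : ℕ) : ZMod 2) = k)
    {f : PreCochain B (n + 2)} (hf : f ∈ cochains σ (n + 2)) {g : PreCochain B (n + 1)}
    (hg : g ∈ cochains σ (n + 1)) (hb : bOp σ (n + 1) g = f) (hB : bigBOp σ n g = 0) :
    IsTotalCoboundary σ k (single (n + 2) f) := by
  refine ⟨single_mem_totalCochains hn hf, single (n + 1) g,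
    single_mem_totalCochains ?_ hg, ?_⟩
  -- The degree `n + 1` of the primitive and `(n + 2) + 1` differ by two, hence agree in `ZMod 2`.
  · rw [← hn]
    push_cast
    linear_combination -(CharTwo.two_eq_zero (R := ZMod 2))
  · rw [bPlusB_single, hb, hB, single_zero, add_zero]

theorem lambdaOp_one_apply (f : PreCochain B 1) (b : Fin 2 → B) :
    lambdaOp σ 1 f b = -f ![σ (b 1), b 0] := by
  have e : (Fin.cons (σ (b (Fin.last 1))) fun i : Fin 1 => b i.castSucc) = ![σ (b 1), b 0] := by
    ext i; fin_cases i <;> rfl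
  rw [lambdaOp, e]
  ring

theorem lambdaOp_two_apply (f : PreCochain B 2) (b : Fin 3 → B) :
    lambdaOp σ 2 f b = f ![σ (b 2), b 0, b 1] := by
  have e : (Fin.cons (σ (b (Fin.last 2))) fun i : Fin 2 => b i.castSucc) =
      ![σ (b 2), b 0, b 1] := by
    ext i; fin_cases i <;> rfl
  rw [lambdaOp, e]
  ring

theorem bigBOp_zero_apply (f : PreCochain B 1) (b : Fin 1 → B) :
    bigBOp σ 0 f b = f ![1, b 0] + f ![b 0, 1] := by
  rw [bigBOp, nOp, Finset.sum_range_one, Function.iterate_zero, id, bZeroOp_zero_apply]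

/-- Here `N = 1 + λ`, and `λ` carries the sign `-1` in degree one. -/
theorem bigBOp_one_apply (f : PreCochain B 2) (b : Fin 2 → B) :
    bigBOp σ 1 f b = (f ![1, b 0, b 1] - f ![b 0, b 1, 1]) -
      (f ![1, σ (b 1), b 0] - f ![σ (b 1), b 0, 1]) := by
  rw [bigBOp, nOp, Finset.sum_range_succ, Finset.sum_range_one, Function.iterate_zero, id,
    Function.iterate_one, Pi.add_apply, lambdaOp_one_apply, bZeroOp_one_apply, bZeroOp_one_apply,
    ← sub_eq_add_neg]
  rfl

theorem bOp_one_apply (f : PreCochain B 1) (b : Fin 3 → B) :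
    bOp σ 1 f b = f ![b 0 * b 1, b 2] - f ![b 0, b 1 * b 2] + f ![σ (b 2) * b 0, b 1] := by
  have e0 : Fin.contractNth (0 : Fin 2).castSucc (· * ·) b = ![b 0 * b 1, b 2] := by
    ext i; fin_cases i <;> rfl
  have e1 : Fin.contractNth (1 : Fin 2).castSucc (· * ·) b = ![b 0, b 1 * b 2] := by
    ext i; fin_cases i <;> rfl
  have e2 : (Fin.cons (σ (b (Fin.last 2)) * b 0) fun i : Fin 1 => b i.succ.castSucc) =
      ![σ (b 2) * b 0, b 1] := by
    ext i; fin_cases i <;> rfl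
  rw [bOp, e2, Fin.sum_univ_two, e0, e1, Fin.val_zero, Fin.val_one]
  ring

theorem bOp_two_apply (f : PreCochain B 2) (b : Fin 4 → B) :
    bOp σ 2 f b = f ![b 0 * b 1, b 2, b 3] - f ![b 0, b 1 * b 2, b 3] +
      f ![b 0, b 1, b 2 * b 3] - f ![σ (b 3) * b 0, b 1, b 2] := by
  have e0 : Fin.contractNth (0 : Fin 3).castSucc (· * ·) b = ![b 0 * b 1, b 2, b 3] := by
    ext i; fin_cases i <;> rfl
  have e1 : Fin.contractNth (1 : Fin 3).castSucc (· * ·) b = ![b 0, b 1 * b 2, b 3] := by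
    ext i; fin_cases i <;> rfl
  have e2 : Fin.contractNth (2 : Fin 3).castSucc (· * ·) b = ![b 0, b 1, b 2 * b 3] := by
    ext i; fin_cases i <;> rfl
  have e3 : (Fin.cons (σ (b (Fin.last 3)) * b 0) fun i : Fin 2 => b i.succ.castSucc) =
      ![σ (b 3) * b 0, b 1, b 2] := by
    ext i; fin_cases i <;> rfl
  rw [bOp, e3, Fin.sum_univ_three, e0, e1, e2, Fin.val_zero, Fin.val_one, Fin.val_two]
  ring

end TwistedCyclic

/-! ### The cochains `τ₁`, `τ₂`, `τ` and the primitive on the quantum sphere -/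

namespace QuantumSU2

open TwistedCyclic

variable (q : Set.Ioo (0 : ℝ) 1)

/-- The cochain `h(b₀ ∂_e ∂_f(b₁))`. -/
def laplaceCochain : PreCochain (Sphere q) 1 := fun b =>
  haar q (b 0 * del (eFun q) (del (fFun q) (b 1)))

theorem haar_act_rho (a : Poly q) : haar q (act (rhoHom q).toLinearMap a) = haar q a := by
  simp [haar_act]

/-- Invariance under `σ` holds because the right action of `ρ` is multiplicative, commutes with
`∂_e` and `∂_f`, and preserves `h`. -/
theorem tau1_mem : tau1 q ∈ cochains (twist q) 2 := by
  refine ⟨⟨(haar q).compMultilinearMap ((MultilinearMap.mkPiAlgebraFin ℂ 3 (Poly q)).compLinearMap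
    ![(Sphere q).val.toLinearMap, del (eFun q) ∘ₗ (Sphere q).val.toLinearMap,
      del (fFun q) ∘ₗ (Sphere q).val.toLinearMap]), fun b => ?_⟩, fun b => ?_⟩
  · simp [tau1, List.ofFn_succ]
  · simp only [tau1, coe_twist, del_act, ← act_char_mul, haar_act_rho]

theorem tau2_mem : tau2 q ∈ cochains (twist q) 2 := by
  refine ⟨⟨(haar q).compMultilinearMap ((MultilinearMap.mkPiAlgebraFin ℂ 3 (Poly q)).compLinearMap
    ![(Sphere q).val.toLinearMap, del (fFun q) ∘ₗ (Sphere q).val.toLinearMap,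
      del (eFun q) ∘ₗ (Sphere q).val.toLinearMap]), fun b => ?_⟩, fun b => ?_⟩
  · simp [tau2, List.ofFn_succ]
  · simp only [tau2, coe_twist, del_act, ← act_char_mul, haar_act_rho]

theorem laplaceCochain_mem : laplaceCochain q ∈ cochains (twist q) 1 := by
  refine ⟨⟨(haar q).compMultilinearMap ((MultilinearMap.mkPiAlgebraFin ℂ 2 (Poly q)).compLinearMap
    ![(Sphere q).val.toLinearMap, del (eFun q) ∘ₗ del (fFun q) ∘ₗ (Sphere q).val.toLinearMap]),
    fun b => ?_⟩, fun b => ?_⟩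
  · simp [laplaceCochain, List.ofFn_succ]
  · simp only [laplaceCochain, coe_twist, del_act, ← act_char_mul, haar_act_rho]

theorem tau_eq : tau q = qc q ^ 2 • tau1 q - tau2 q := by
  ext b
  simp only [tau, tau1, tau2, mul_sub, map_sub, mul_smul_comm, map_smul, Pi.sub_apply,
    Pi.smul_apply]

/-- The twisted trace property turns the last term into `h(b₀ ∂_e(b₁) ∂_f(b₂) b₃)`; after expanding
by the Leibniz rules all terms cancel in pairs. -/
theorem bOp_tau1 : bOp (twist q) 2 (tau1 q) = 0 := by
  ext b
  rw [bOp_two_apply]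
  simp only [tau1, Matrix.cons_val, MulMemClass.coe_mul, e_mul_sphere, f_mul_sphere, Pi.zero_apply,
    mul_assoc, ← haar_mul_sphere]
  simp only [mul_add, add_mul, map_add, ← mul_assoc]
  ring

theorem bOp_tau2 : bOp (twist q) 2 (tau2 q) = 0 := by
  ext b
  rw [bOp_two_apply]
  simp only [tau2, Matrix.cons_val, MulMemClass.coe_mul, e_mul_sphere, f_mul_sphere, Pi.zero_apply,
    mul_assoc, ← haar_mul_sphere]
  simp only [mul_add, add_mul, map_add, ← mul_assoc]
  ring

/-! ### Integration by parts: the operator `B`, cyclicity and the coboundary -/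

variable {q}

/-- Integration by parts for `∂_e`. -/
theorem haar_e_mul_f (a b : Sphere q) :
    qc q * haar q (del (eFun q) (a : Poly q) * del (fFun q) (b : Poly q)) =
      -haar q (a * del (eFun q) (del (fFun q) (b : Poly q))) := by
  have h := haar_e q (a * del (fFun q) (b : Poly q))
  rw [e_mul, k_sphere, kInv_f_sphere, mul_smul_comm, map_add, map_smul, smul_eq_mul] at h
  linear_combination h

/-- Now `∂_f` is integrated, from `∂_e(a) b`, and `∂_f ∂_e(a) = ∂_e ∂_f(a)` is used. Together with
`haar_e_mul_f` this makes `∂_e ∂_f` symmetric for the pairing `h(a b)` on `𝓑`. -/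
theorem haar_e_mul_f' (a b : Sphere q) :
    qc q * haar q (del (eFun q) (a : Poly q) * del (fFun q) (b : Poly q)) =
      -haar q (del (eFun q) (del (fFun q) (a : Poly q)) * b) := by
  have h := haar_f q (del (eFun q) (a : Poly q) * b)
  rw [f_mul, kInv_sphere, k_e_sphere, smul_mul_assoc, map_add, map_smul, smul_eq_mul,
    ← e_f_sphere] at h
  linear_combination h

/-- Integration by parts for `∂_f`. -/
theorem haar_f_mul_e (a b : Sphere q) :
    haar q (del (fFun q) (a : Poly q) * del (eFun q) (b : Poly q)) =
      -(qc q * haar q (a * del (eFun q) (del (fFun q) (b : Poly q)))) := by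
  have hq := qc_ne_zero q
  have h := haar_f q (a * del (eFun q) (b : Poly q))
  rw [f_mul, k_sphere, kInv_e_sphere, mul_smul_comm, map_add, map_smul, smul_eq_mul,
    ← e_f_sphere] at h
  field_simp at h
  linear_combination h

theorem haar_f_mul_e' (a b : Sphere q) :
    haar q (del (fFun q) (a : Poly q) * del (eFun q) (b : Poly q)) =
      -(qc q * haar q (del (eFun q) (del (fFun q) (a : Poly q)) * b)) := by
  have hq := qc_ne_zero q
  have h := haar_e q (del (fFun q) (a : Poly q) * b)
  rw [e_mul, kInv_sphere, k_f_sphere, smul_mul_assoc, map_add, map_smul, smul_eq_mul] at h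
  field_simp at h
  linear_combination h

variable (q)

/-- Terms with `1` in a differentiated slot vanish, leaving `h(∂_e(b₀) ∂_f(b₁)) - h(∂_e(σ(b₁))
∂_f(b₀))`. -/
theorem bigBOp_tau1 : bigBOp (twist q) 1 (tau1 q) = 0 := by
  ext b
  rw [bigBOp_one_apply]
  simp only [tau1, Matrix.cons_val, OneMemClass.coe_one, f_one, mul_zero, map_zero, one_mul,
    sub_zero, Pi.zero_apply]
  refine (mul_eq_zero.1 ?_).resolve_left (qc_ne_zero q)
  -- The first term is integrated so that `∂_e ∂_f` falls on `b₁`, the second so that it falls on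
  -- `σ(b₁)`; the twisted trace property identifies the results.
  rw [mul_sub, haar_e_mul_f, haar_e_mul_f', haar_mul_e_f, sub_self]

theorem bigBOp_tau2 : bigBOp (twist q) 1 (tau2 q) = 0 := by
  ext b
  rw [bigBOp_one_apply]
  simp only [tau2, Matrix.cons_val, OneMemClass.coe_one, e_one, mul_zero, map_zero, one_mul,
    sub_zero, Pi.zero_apply]
  rw [haar_f_mul_e, haar_f_mul_e', haar_mul_e_f, sub_self]

theorem lambdaOp_tau : lambdaOp (twist q) 2 (tau q) = tau q := by
  have hq := qc_ne_zero q
  ext b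
  rw [lambdaOp_two_apply, tau_eq]
  simp only [tau1, tau2, Matrix.cons_val, Pi.sub_apply, Pi.smul_apply, smul_eq_mul,
    ← haar_mul_sphere]
  -- After the twisted trace step `λ τ` reads `h((q² ∂_e(b₀) ∂_f(b₁) - ∂_f(b₀) ∂_e(b₁)) b₂)`. In the
  -- difference of these two identities, scaled by `q`, the terms `h(b₀ ∂_e ∂_f(b₁) b₂)` cancel and
  -- `λ τ - τ = 0` remains.
  have h1 := haar_e q (b 0 * (del (fFun q) (b 1 : Poly q) * b 2))
  have h2 := haar_f q (b 0 * (del (eFun q) (b 1 : Poly q) * b 2))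
  simp only [e_mul, f_mul, kInv_mul, k_sphere, kInv_sphere, kInv_e_sphere, kInv_f_sphere,
    k_e_sphere, k_f_sphere, mul_add, map_add, mul_smul_comm, smul_mul_assoc, map_smul,
    smul_eq_mul, ← e_f_sphere] at h1 h2
  simp only [mul_assoc] at h1 h2 ⊢
  field_simp at h1 h2
  linear_combination h1 - h2

/-- With the twisted trace property, `b` of the Laplace cochain is minus `h(b₀ · )` applied to the
Leibniz defect `q ∂_e(b₁) ∂_f(b₂) + q⁻¹ ∂_f(b₁) ∂_e(b₂)` of `∂_e ∂_f`; the factor `-q` clears the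
sign and the inverse. -/
theorem bOp_laplaceCochain :
    bOp (twist q) 1 (-qc q • laplaceCochain q) = qc q ^ 2 • tau1 q + tau2 q := by
  have hq := qc_ne_zero q
  rw [bOp_smul]
  ext b
  rw [Pi.smul_apply, bOp_one_apply]
  simp only [laplaceCochain, tau1, tau2, Matrix.cons_val, MulMemClass.coe_mul, f_mul_sphere,
    map_add, e_mul, k_sphere, kInv_sphere, kInv_f_sphere, k_f_sphere, mul_add, mul_smul_comm,
    smul_mul_assoc, map_smul, smul_eq_mul, Pi.add_apply, Pi.smul_apply, mul_assoc,
    ← haar_mul_sphere]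
  field_simp
  ring

/-- One term is `h` of an element in the range of `∂_e`, the other contains `∂_f(1) = 0`. -/
theorem bigBOp_laplaceCochain : bigBOp (twist q) 0 (-qc q • laplaceCochain q) = 0 := by
  rw [bigBOp_smul]
  ext b
  rw [Pi.smul_apply, bigBOp_zero_apply]
  simp [laplaceCochain, f_one, haar_e, -del_one]

/-- The total cocycles given by the combinations of `τ₁` and `τ₂`. -/
theorem isTotalCocycle_tau (c d : ℂ) :
    IsTotalCocycle (twist q) 0 (single 2 (c • tau1 q + d • tau2 q)) := by
  refine isTotalCocycle_single (by decide) ?_ ?_ ?_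
  · exact add_mem (Submodule.smul_mem _ _ (tau1_mem q)) (Submodule.smul_mem _ _ (tau2_mem q))
  · rw [bOp_add, bOp_smul, bOp_smul, bOp_tau1, bOp_tau2]
    simp
  · rw [bigBOp_add, bigBOp_smul, bigBOp_smul, bigBOp_tau1, bigBOp_tau2]
    simp

theorem isTotalCoboundary_tau (c : ℂ) :
    IsTotalCoboundary (twist q) 0 (single 2 (c • (qc q ^ 2 • tau1 q + tau2 q))) := by
  refine isTotalCoboundary_single (by decide) (Submodule.smul_mem _ _ (add_mem
    (Submodule.smul_mem _ _ (tau1_mem q)) (tau2_mem q)))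
    (g := c • (-qc q • laplaceCochain q)) (Submodule.smul_mem _ _ (Submodule.smul_mem _ _
      (laplaceCochain_mem q))) ?_ ?_
  · rw [bOp_smul, bOp_laplaceCochain]
  · rw [bigBOp_smul, bigBOp_laplaceCochain, smul_zero]

/-- The two conditions say that the difference is `z` times the coboundary `q² τ₁ + τ₂`. -/
theorem areCohomologous_tau {c d c' d' : ℂ} (z : ℂ) (hc : c - c' = z * qc q ^ 2)
    (hd : d - d' = z) : AreCohomologous (twist q) 0 (single 2 (c • tau1 q + d • tau2 q))
      (single 2 (c' • tau1 q + d' • tau2 q)) := by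
  refine ⟨isTotalCocycle_tau q c d, isTotalCocycle_tau q c' d', ?_⟩
  have e : c • tau1 q + d • tau2 q - (c' • tau1 q + d' • tau2 q) =
      z • (qc q ^ 2 • tau1 q + tau2 q) := by
    rw [smul_add, smul_smul, ← hc, ← hd]
    module
  rw [← single_sub, e]
  exact isTotalCoboundary_tau q z

end QuantumSU2

end

open TwistedCyclic QuantumSU2

theorem proposition2p2 (q : Set.Ioo (0 : ℝ) 1) :
    -- (i) `τ` is a cocycle in the twisted cyclic complex of `𝓑`
    TwistedCyclic.IsCyclicCocycle (QuantumSU2.twist q) 2 (QuantumSU2.tau q) ∧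
    -- (ii) `τ₁` and `τ₂` are cocycles in the complex `(𝓒^•_σ(𝓑), b + B)`
    TwistedCyclic.IsTotalCocycle (QuantumSU2.twist q) 0
      (TwistedCyclic.single 2 (QuantumSU2.tau1 q)) ∧
    TwistedCyclic.IsTotalCocycle (QuantumSU2.twist q) 0
      (TwistedCyclic.single 2 (QuantumSU2.tau2 q)) ∧
    -- (iii) `q² τ₁ + τ₂` is a coboundary in this complex
    TwistedCyclic.IsTotalCoboundary (QuantumSU2.twist q) 0
      (TwistedCyclic.single 2
        (((q : ℝ) : ℂ) ^ 2 • QuantumSU2.tau1 q + QuantumSU2.tau2 q)) ∧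
    -- in particular, the cocycles `τ`, `2 q² τ₁` and `-2 τ₂` are cohomologous
    TwistedCyclic.AreCohomologous (QuantumSU2.twist q) 0
      (TwistedCyclic.single 2 (QuantumSU2.tau q))
      (TwistedCyclic.single 2 ((2 * ((q : ℝ) : ℂ) ^ 2) • QuantumSU2.tau1 q)) ∧
    TwistedCyclic.AreCohomologous (QuantumSU2.twist q) 0
      (TwistedCyclic.single 2 (QuantumSU2.tau q))
      (TwistedCyclic.single 2 ((-2 : ℂ) • QuantumSU2.tau2 q)) ∧
    TwistedCyclic.AreCohomologous (QuantumSU2.twist q) 0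
      (TwistedCyclic.single 2 ((2 * ((q : ℝ) : ℂ) ^ 2) • QuantumSU2.tau1 q))
      (TwistedCyclic.single 2 ((-2 : ℂ) • QuantumSU2.tau2 q)) := by
  have e : tau q = qc q ^ 2 • tau1 q + (-1 : ℂ) • tau2 q := by rw [tau_eq]; module
  have e1 : tau1 q = (1 : ℂ) • tau1 q + (0 : ℂ) • tau2 q := by module
  have e2 : tau2 q = (0 : ℂ) • tau1 q + (1 : ℂ) • tau2 q := by module
  have e3 : (2 * qc q ^ 2) • tau1 q = (2 * qc q ^ 2) • tau1 q + (0 : ℂ) • tau2 q := by module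
  have e4 : (-2 : ℂ) • tau2 q = (0 : ℂ) • tau1 q + (-2 : ℂ) • tau2 q := by module
  have hq : ((q : ℝ) : ℂ) = qc q := rfl
  rw [hq]
  refine ⟨⟨?_, lambdaOp_tau q, ?_⟩, ?_, ?_, ?_, ?_, ?_, ?_⟩
  · rw [tau_eq]
    exact sub_mem (Submodule.smul_mem _ _ (tau1_mem q)) (tau2_mem q)
  · rw [e, bOp_add, bOp_smul, bOp_smul, bOp_tau1, bOp_tau2, smul_zero, smul_zero, add_zero]
  · rw [e1]
    exact isTotalCocycle_tau q 1 0
  · rw [e2]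
    exact isTotalCocycle_tau q 0 1
  · simpa using isTotalCoboundary_tau q 1
  -- The multipliers are read off from `τ - 2q² τ₁ = -(q² τ₁ + τ₂)`, `τ + 2τ₂ = q² τ₁ + τ₂` and `2q²
  -- τ₁ + 2τ₂ = 2(q² τ₁ + τ₂)`.
  · rw [e, e3]
    exact areCohomologous_tau q (-1) (by ring) (by ring)
  · rw [e, e4]
    exact areCohomologous_tau q 1 (by ring) (by ring)
  · rw [e3, e4]
    exact areCohomologous_tau q 2 (by ring) (by ring)
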